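/- For a finite group $G$, let $$P(G)=\frac{|\{(g,h)\in G\times G: gh=hg\}|}{|G|^2}$$ be its commuting probability, and let $S=\{P(G): G\text{ a finite group}\}\subseteq(0,1]$. Then $S$, taken with the opposite of the usual ordering of real numbers (so that $x$ precedes $y$ if and only if $x>y$), is well-ordered, and its order type is the ordinal $\omega^\omega$ (ordinal exponentiation). -/

import Mathlib

open scoped Ordinal

/-- The set `S` of all commuting probabilities of finite groups, as a set of real numbers.
Here `commProb G = #{(g, h) ∈ G × G : g h = h g} / #G ^ 2`. The groups range over the types in
`Type`, which is no restriction: see `commProb_mem_commProbSet`. -/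
def commProbSet : Set ℝ :=
  {x : ℝ | ∃ (G : Type) (_ : Group G) (_ : Finite G), x = (commProb G : ℝ)}

/-- A finite group in any universe has its commuting probability in `commProbSet`. -/
theorem commProb_mem_commProbSet (G : Type*) [Group G] [Finite G] :
    (commProb G : ℝ) ∈ commProbSet := by
  have f : Shrink.{0} G ≃* G := Shrink.mulEquiv
  refine ⟨Shrink.{0} G, inferInstance, inferInstance, ?_⟩
  rw [commProb_def', commProb_def', Nat.card_congr f.toEquiv]
  have h : Nat.card (ConjClasses (Shrink.{0} G)) = Nat.card (ConjClasses G) := by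
    refine Nat.card_congr (Quotient.congr f.toEquiv fun a b => ?_)
    change IsConj a b ↔ IsConj (f a) (f b)
    refine ⟨fun h => f.toMonoidHom.map_isConj h, fun h => ?_⟩
    simpa using f.symm.toMonoidHom.map_isConj h
  rw [h]

/-! ### Transfinite decreasing sequences of reals -/

section OrderTypes

open Set Filter Topology Ordinal
open scoped Pointwise

/-! The order type is at least `ω ^ ω` because commuting probabilities multiply under direct
products and those of the odd dihedral groups decrease to 1/4. Products of them accumulate from
above at (1/4)^k with order type `ω ^ k` (`containsDecreasing_commProbSet_near`).

For the upper bound, fix ε > 0. By Neumann's argument (`exists_isBoundedlyAbelian`), a group with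
commuting probability at least ε has a normal subgroup H of class at most two with bounded index and
bounded commutator subgroup. Counting commuting pairs coset by coset and detecting triviality in the
commutator subgroup of H by characters reduces the probability to means of quadratic phases. Such a
mean is c / m with c in a finite set, since a maximal isotropic subgroup has bounded index in its
orthogonal (`card_orthogonal_le`). So the probabilities above ε lie in one set of sums of M
fractions with finitely many numerators. That set is compact, and each passage to accumulation
points removes a summand, so it has no decreasing family of type `ω ^ (M + 1)`
(`not_containsDecreasing_fractionSums`).

Well-foundedness does not follow from this, as the numerators may be negative. It is proved by
induction on the bound for the commutator subgroup of H (`wellFoundedOn_boundedCommProbSet`). Either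
`commProb G` is barely above `commProb (G ⧸ ⁅H, H⁆)` divided by the order of that commutator
subgroup, which is a sum of fractions with nonnegative numerators, or H can be replaced by a
subgroup of bounded index with a smaller commutator subgroup. -/

/-- `A` contains a strictly decreasing family of reals indexed by the ordinals below `o`. -/
def ContainsDecreasing (A : Set ℝ) (o : Ordinal.{0}) : Prop :=
  ∃ a : Ordinal.{0} → ℝ, StrictAntiOn a (Iio o) ∧ MapsTo a (Iio o) A

theorem ContainsDecreasing.mono {A B : Set ℝ} {o : Ordinal.{0}} (h : ContainsDecreasing A o)
    (hAB : A ⊆ B) : ContainsDecreasing B o :=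
  let ⟨a, ha, hA⟩ := h
  ⟨a, ha, fun _ hx => hAB (hA hx)⟩

theorem ContainsDecreasing.le_type {A : Set ℝ} {o : Ordinal.{0}} (h : ContainsDecreasing A o)
    [IsWellOrder A (fun x y => x > y)] :
    o ≤ Ordinal.type (fun x y : A => x > y) := by
  obtain ⟨a, ha, hA⟩ := h
  have key : ∀ i : o.ToType, typein (α := o.ToType) (· < ·) i ∈ Iio o := fun i => typein_lt_self i
  rw [← type_toType o]
  refine type_le_iff'.2 ⟨⟨⟨fun i => ⟨a (typein (α := o.ToType) (· < ·) i), hA (key i)⟩, ?_⟩, ?_⟩⟩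
  · intro i j hij
    have := ha.injOn (key i) (key j) (congrArg Subtype.val hij)
    exact typein_injective _ this
  · intro i j
    change a _ < a _ ↔ _
    rw [ha.lt_iff_gt (key j) (key i)]
    exact typein_lt_typein _

theorem containsDecreasing_of_le_typein {A : Set ℝ} [IsWellOrder A (fun x y => x > y)] (x : A)
    {o : Ordinal.{0}} (h : o ≤ typein (fun x y : A => x > y) x) :
    ContainsDecreasing (A ∩ Ici (x : ℝ)) o := by
  classical
  have hlt : ∀ {p}, p < o → p < type (fun x y : A => x > y) := fun hp =>
    hp.trans_le (h.trans (typein_lt_type _ x).le)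
  refine ⟨fun p => if hp : p < o then (enum (fun x y : A => x > y) ⟨p, hlt hp⟩ : A) else 0, ?_, ?_⟩
  · intro p hp q hq hpq
    simp only [mem_Iio] at hp hq
    simp only [dif_pos hp, dif_pos hq]
    have := (enum_lt_enum (r := fun x y : A => x > y) (o₁ := ⟨p, hlt hp⟩) (o₂ := ⟨q, hlt hq⟩)).2 hpq
    exact this
  · intro p hp
    simp only [mem_Iio] at hp
    simp only [dif_pos hp]
    refine ⟨Subtype.coe_prop _, ?_⟩
    have : (fun x y : A => x > y) (enum (fun x y : A => x > y) ⟨p, hlt hp⟩) x := by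
      refine (typein_lt_typein (fun x y : A => x > y)).1 ?_
      exact (typein_enum (fun x y : A => x > y) (hlt hp)).trans_lt (hp.trans_le h)
    exact le_of_lt this

/-- By compactness, an ultrafilter of pairs whose sums tend to x without equalling x converges to
some (a, b) with a + b = x. Either the first coordinate eventually avoids a, or it eventually equals
a, and then the second must avoid b. -/
theorem derivedSet_add_subset {A B : Set ℝ} (hA : IsCompact A) (hB : IsCompact B) :
    derivedSet (A + B) ⊆ (derivedSet A + B) ∪ (A + derivedSet B) := by
  intro x hx
  rw [mem_derivedSet, accPt_iff_frequently_nhdsNE] at hx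
  set l : Filter (ℝ × ℝ) := comap (fun p => p.1 + p.2) (𝓝[≠] x) ⊓ 𝓟 (A ×ˢ B) with hl
  have hne : NeBot l := by
    rw [hl, inf_principal_neBot_iff]
    rintro U ⟨V, hV, hVU⟩
    obtain ⟨y, ⟨a, ha, b, hb, rfl⟩, hy⟩ := (hx.and_eventually hV).exists
    exact ⟨(a, b), hVU hy, ha, hb⟩
  obtain ⟨⟨a, b⟩, ⟨ha, hb⟩, hab⟩ := (hA.prod hB) (inf_le_right : l ≤ _)
  obtain ⟨U, hUl, hUab⟩ := clusterPt_iff_ultrafilter.1 hab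
  rw [nhds_prod_eq] at hUab
  have h1 : Tendsto Prod.fst (U : Filter (ℝ × ℝ)) (𝓝 a) := tendsto_fst.mono_left hUab
  have h2 : Tendsto Prod.snd (U : Filter (ℝ × ℝ)) (𝓝 b) := tendsto_snd.mono_left hUab
  have h3 : Tendsto (fun p : ℝ × ℝ => p.1 + p.2) (U : Filter (ℝ × ℝ)) (𝓝[≠] x) :=
    tendsto_comap.mono_left (hUl.trans inf_le_left)
  have hmem : ∀ᶠ p in (U : Filter (ℝ × ℝ)), p ∈ A ×ˢ B :=
    (hUl.trans inf_le_right) (mem_principal_self _)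
  have hx' : a + b = x := tendsto_nhds_unique (h1.add h2) (h3.mono_right nhdsWithin_le_nhds)
  by_cases hU : ∀ᶠ p in (U : Filter (ℝ × ℝ)), p.1 ≠ a
  · refine Or.inl ⟨a, ?_, b, hb, hx'⟩
    rw [mem_derivedSet, accPt_iff_frequently_nhdsNE]
    have : Tendsto Prod.fst (U : Filter (ℝ × ℝ)) (𝓝[≠] a) :=
      tendsto_nhdsWithin_iff.2 ⟨h1, hU⟩
    exact this.frequently (hmem.mono fun p hp => hp.1).frequently
  · refine Or.inr ⟨a, ha, b, ?_, hx'⟩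
    rw [Ultrafilter.eventually_not] at hU
    push Not at hU
    have hne' : ∀ᶠ p in (U : Filter (ℝ × ℝ)), p.2 ≠ b := by
      filter_upwards [hU, h3 self_mem_nhdsWithin] with p hp hp' hb'
      exact hp' (by simp [hp, hb', hx'])
    rw [mem_derivedSet, accPt_iff_frequently_nhdsNE]
    have : Tendsto Prod.snd (U : Filter (ℝ × ℝ)) (𝓝[≠] b) :=
      tendsto_nhdsWithin_iff.2 ⟨h2, hne'⟩
    exact this.frequently (hmem.mono fun p hp => hp.2).frequently

/-- The fractions `c / m` with numerator in `C` and positive integer denominator. -/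
def fractions (C : Set ℝ) : Set ℝ :=
  {x | ∃ c ∈ C, ∃ m : ℕ, 0 < m ∧ x = c / m}

/-- Sums of `M` fractions with numerators in `C`. -/
def fractionSums (C : Set ℝ) : ℕ → Set ℝ
  | 0 => {0}
  | M + 1 => fractionSums C M + fractions C

theorem tendsto_div_succ (c : ℝ) : Tendsto (fun n : ℕ => c / ((n : ℝ) + 1)) atTop (𝓝 0) := by
  simpa [div_eq_mul_inv] using (tendsto_one_div_add_atTop_nhds_zero_nat (𝕜 := ℝ)).const_mul c

theorem fractions_eq_biUnion (C : Set ℝ) :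
    fractions C = ⋃ c ∈ C, range fun n : ℕ => c / ((n : ℝ) + 1) := by
  ext x
  simp only [fractions, mem_ofPred_eq, mem_iUnion, mem_range, exists_prop]
  constructor
  · rintro ⟨c, hc, m, hm, rfl⟩
    refine ⟨c, hc, m - 1, ?_⟩
    rw [← Nat.cast_succ, Nat.succ_eq_add_one, Nat.sub_add_cancel hm]
  · rintro ⟨c, hc, n, rfl⟩
    exact ⟨c, hc, n + 1, n.succ_pos, by push_cast; rfl⟩

theorem zero_mem_fractions {C : Set ℝ} (h0 : (0 : ℝ) ∈ C) : (0 : ℝ) ∈ fractions C :=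
  ⟨0, h0, 1, one_pos, by simp⟩

theorem isCompact_fractions {C : Set ℝ} (hC : C.Finite) (h0 : (0 : ℝ) ∈ C) :
    IsCompact (fractions C) := by
  have : fractions C = ⋃ c ∈ C, insert 0 (range fun n : ℕ => c / ((n : ℝ) + 1)) := by
    apply subset_antisymm
    · rw [fractions_eq_biUnion]
      exact iUnion₂_mono fun c hc => subset_insert _ _
    · refine iUnion₂_subset fun c hc => insert_subset (zero_mem_fractions h0) ?_
      rw [fractions_eq_biUnion]
      exact subset_iUnion₂ (s := fun c _ => range fun n : ℕ => c / ((n : ℝ) + 1)) c hc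
  rw [this]
  exact hC.isCompact_biUnion fun c _ => (tendsto_div_succ c).isCompact_insert_range

theorem derivedSet_range_subset {u : ℕ → ℝ} (hu : Tendsto u atTop (𝓝 0)) :
    derivedSet (range u) ⊆ {0} := by
  intro x hx
  by_contra hx0
  rw [mem_derivedSet, accPt_iff_frequently_nhdsNE] at hx
  obtain ⟨V, W, hV, hW, hVx, hW0, hVW⟩ := t2_separation hx0
  have hfin : {n | u n ∉ W}.Finite := by
    have := hu.eventually (hW.mem_nhds hW0)
    rwa [← Nat.cofinite_eq_atTop, eventually_cofinite] at this
  have hV' : V \ (u '' {n | u n ∉ W} \ {x}) ∈ 𝓝 x :=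
    (hV.sdiff ((hfin.image u).subset sdiff_subset).isClosed).mem_nhds ⟨hVx, by simp⟩
  obtain ⟨_, ⟨n, rfl⟩, hn, hne⟩ :=
    (hx.and_eventually ((eventually_nhdsWithin_of_eventually_nhds hV').and
      self_mem_nhdsWithin)).exists
  refine hn.2 ⟨⟨n, fun hW => ?_, rfl⟩, hne⟩
  exact disjoint_left.1 hVW hn.1 hW

theorem derivedSet_fractions_subset {C : Set ℝ} (hC : C.Finite) :
    derivedSet (fractions C) ⊆ {0} := by
  rw [fractions_eq_biUnion]
  induction C, hC using Set.Finite.induction_on with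
  | empty => intro x hx; simp [mem_derivedSet, AccPt, neBot_iff] at hx
  | insert _ _ ih =>
    rw [biUnion_insert, derivedSet_union]
    exact union_subset (derivedSet_range_subset (tendsto_div_succ _)) ih

theorem isCompact_fractionSums {C : Set ℝ} (hC : C.Finite) (h0 : (0 : ℝ) ∈ C) (M : ℕ) :
    IsCompact (fractionSums C M) := by
  induction M with
  | zero => exact isCompact_singleton
  | succ M ih => exact ih.add (isCompact_fractions hC h0)

/-- A Leibniz rule: fractions accumulate only at 0, so at an accumulation point of the sums one
summand has degenerated to 0. -/
theorem derivedSet_fractionSums_subset {C : Set ℝ} (hC : C.Finite) (h0 : (0 : ℝ) ∈ C) (M : ℕ) :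
    derivedSet (fractionSums C (M + 1)) ⊆ fractionSums C M := by
  refine (derivedSet_add_subset (isCompact_fractionSums hC h0 M)
    (isCompact_fractions hC h0)).trans (union_subset ?_ ?_)
  · cases M with
    | zero =>
      have : derivedSet (fractionSums C 0) = ∅ := by
        ext x
        simp only [mem_derivedSet, fractionSums, mem_empty_iff_false, iff_false]
        rw [accPt_iff_frequently_nhdsNE]
        intro h
        have h' := h.and_eventually self_mem_nhdsWithin
        obtain ⟨y, hy, hyx⟩ := h'.exists
        have : ∀ᶠ y in 𝓝[≠] x, y ≠ 0 := by
          obtain rfl | hx := eq_or_ne x 0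
          · exact self_mem_nhdsWithin
          · exact eventually_nhdsWithin_of_eventually_nhds (isOpen_ne.mem_nhds hx)
        obtain ⟨z, hz, hz0⟩ := (h.and_eventually this).exists
        exact hz0 hz
      rw [this, empty_add]
      exact empty_subset _
    | succ M =>
      exact add_subset_add_right (derivedSet_fractionSums_subset hC h0 M)
  · refine (add_subset_add_left (derivedSet_fractions_subset hC)).trans ?_
    simp

/-- Cut the family into consecutive sequences of type ω. Their infima are accumulation points and
again decrease strictly, so one derivation costs one factor ω and one summand. -/
theorem not_containsDecreasing_fractionSums {C : Set ℝ} (hC : C.Finite) (h0 : (0 : ℝ) ∈ C)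
    (M : ℕ) : ¬ ContainsDecreasing (fractionSums C M) (ω ^ ((M + 1 : ℕ) : Ordinal.{0})) := by
  induction M with
  | zero =>
    rintro ⟨a, ha, hA⟩
    have h : ∀ n : ℕ, (n : Ordinal.{0}) ∈ Iio (ω ^ ((0 + 1 : ℕ) : Ordinal.{0})) := fun n => by
      simp
    have h1 : a 0 = 0 := by simpa [fractionSums] using hA (x := 0) (by simp)
    have h2 : a 1 = 0 := by simpa [fractionSums] using hA (x := 1) (by simp)
    have h3 := ha (a := 0) (b := 1) (by simp) (by simp) (zero_lt_one' Ordinal.{0})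
    linarith
  | succ M ih =>
    rintro ⟨a, ha, hA⟩
    apply ih
    set b : Ordinal.{0} := ω ^ ((M + 1 : ℕ) : Ordinal.{0}) with hb
    -- With ω on the left, the product is `b` blocks of type ω, indexed by `ω * γ + n`.
    have hpow : ω ^ ((M + 1 + 1 : ℕ) : Ordinal.{0}) = ω * b := by
      rw [hb, opow_natCast, opow_natCast, pow_succ']
    rw [hpow] at ha hA
    have hmem : ∀ γ < b, ∀ n : ℕ, ω * γ + n < ω * b := fun γ hγ n =>
      calc ω * γ + n < ω * γ + ω := by simp
        _ = ω * Order.succ γ := (mul_succ _ _).symm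
        _ ≤ ω * b := by gcongr; exact Order.succ_le_of_lt hγ
    set u : Ordinal.{0} → ℕ → ℝ := fun γ n => a (ω * γ + n) with hu
    have hanti : ∀ γ < b, StrictAnti (u γ) := fun γ hγ m n hmn =>
      ha (hmem γ hγ m) (hmem γ hγ n) (by simpa using hmn)
    have hbdd : ∀ γ < b, BddBelow (range (u γ)) := fun γ hγ =>
      (isCompact_fractionSums hC h0 (M + 1)).bddBelow.mono
        (range_subset_iff.2 fun n => hA (hmem γ hγ n))
    have hlim : ∀ γ < b, Tendsto (u γ) atTop (𝓝 (⨅ n, u γ n)) := fun γ hγ =>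
      tendsto_atTop_ciInf (hanti γ hγ).antitone (hbdd γ hγ)
    have hlt : ∀ γ < b, ∀ n, ⨅ n, u γ n < u γ n := fun γ hγ n =>
      (ciInf_le (hbdd γ hγ) (n + 1)).trans_lt (hanti γ hγ n.lt_succ_self)
    refine ⟨fun γ => ⨅ n, u γ n, ?_, ?_⟩
    · intro γ hγ γ' hγ' hlt'
      -- The first term of block γ' separates the two infima.
      refine (hlt γ' hγ' 0).trans_le (le_ciInf fun n => ?_)
      refine (ha (hmem γ hγ n) (hmem γ' hγ' 0) ?_).le
      calc ω * γ + n < ω * γ + ω := by simp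
        _ = ω * Order.succ γ := (mul_succ _ _).symm
        _ ≤ ω * γ' := by gcongr; exact Order.succ_le_of_lt hlt'
        _ ≤ _ := by simp
    · intro γ hγ
      apply derivedSet_fractionSums_subset hC h0 M
      rw [mem_derivedSet, accPt_iff_frequently_nhdsNE]
      have : Tendsto (u γ) atTop (𝓝[≠] (⨅ n, u γ n)) :=
        tendsto_nhdsWithin_iff.2 ⟨hlim γ hγ, Eventually.of_forall fun n => (hlt γ hγ n).ne'⟩
      exact this.frequently (Eventually.of_forall fun n => hA (hmem γ hγ n)).frequently

end OrderTypes

/-! ### The lower bound for the order type -/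

section LowerBound

open Set Filter Topology Ordinal

theorem one_mem_commProbSet : (1 : ℝ) ∈ commProbSet := by
  have := commProb_mem_commProbSet Unit
  rwa [commProb_eq_one_iff.2 ⟨⟨fun _ _ => rfl⟩⟩, Rat.cast_one] at this

theorem mul_mem_commProbSet {x y : ℝ} (hx : x ∈ commProbSet) (hy : y ∈ commProbSet) :
    x * y ∈ commProbSet := by
  obtain ⟨G, _, _, rfl⟩ := hx
  obtain ⟨G', _, _, rfl⟩ := hy
  have := commProb_mem_commProbSet (G × G')
  rwa [commProb_prod, Rat.cast_mul] at this

/-- The commuting probability of the dihedral group of order `2 (2 n + 1)`. -/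
noncomputable def dihedralProb (n : ℕ) : ℝ := (2 * n + 4) / (4 * (2 * n + 1))

theorem dihedralProb_mem (n : ℕ) : dihedralProb n ∈ commProbSet := by
  have : NeZero (2 * n + 1) := ⟨by omega⟩
  have h := commProb_mem_commProbSet (DihedralGroup (2 * n + 1))
  rw [DihedralGroup.commProb_odd ⟨n, rfl⟩] at h
  convert h using 1
  rw [dihedralProb]
  push_cast
  congr 1
  ring

theorem dihedralProb_eq (n : ℕ) : dihedralProb n = 1 / 4 + 3 / 4 * (1 / (2 * n + 1)) := by
  rw [dihedralProb]
  field_simp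
  ring

theorem dihedralProb_strictAnti : StrictAnti dihedralProb := by
  refine strictAnti_nat_of_succ_lt fun n => ?_
  rw [dihedralProb_eq, dihedralProb_eq]
  gcongr
  linarith

theorem quarter_lt_dihedralProb (n : ℕ) : 1 / 4 < dihedralProb n := by
  rw [dihedralProb_eq]
  have : (0 : ℝ) < 3 / 4 * (1 / (2 * n + 1)) := by positivity
  linarith

theorem exists_dihedralProb_lt {δ : ℝ} (hδ : 0 < δ) : ∃ N, dihedralProb N ≤ 1 / 4 * (1 + δ) := by
  obtain ⟨N, hN⟩ := exists_nat_gt (3 / δ)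
  refine ⟨N, ?_⟩
  rw [dihedralProb_eq]
  have h1 : 3 * (1 / (2 * (N : ℝ) + 1)) ≤ δ := by
    rw [div_lt_iff₀ hδ] at hN
    rw [mul_one_div, div_le_iff₀ (by positivity)]
    nlinarith
  linarith

/-- The arbitrarily narrow window drives the induction: a copy of `ω ^ k`, scaled by a dihedral
probability, has to fit below the copy scaled by the preceding one. -/
theorem containsDecreasing_commProbSet_near (k : ℕ) : ∀ δ : ℝ, 0 < δ →
    ContainsDecreasing (commProbSet ∩ Ico ((1 / 4) ^ k) ((1 / 4) ^ k * (1 + δ)))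
      (ω ^ (k : Ordinal.{0})) := by
  induction k with
  | zero =>
    intro δ hδ
    refine ⟨fun _ => 1, ?_, fun x _ => ⟨one_mem_commProbSet, by simp, by simpa using hδ⟩⟩
    intro x hx y hy hxy
    simp only [Nat.cast_zero, opow_zero, mem_Iio, Order.lt_one_iff] at hx hy
    simp [hx, hy] at hxy
  | succ k ih =>
    intro δ hδ
    obtain ⟨N, hN⟩ := exists_dihedralProb_lt hδ
    set d : ℕ → ℝ := fun n => dihedralProb (N + n) with hd
    have hd0 : ∀ n, 1 / 4 < d n := fun n => quarter_lt_dihedralProb _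
    have hdpos : ∀ n, 0 < d n := fun n => lt_trans (by norm_num) (hd0 n)
    have hdanti : StrictAnti d := fun m n hmn => dihedralProb_strictAnti (by omega)
    have hstep : ∀ n, 0 < d n / d (n + 1) - 1 := fun n =>
      sub_pos.2 ((one_lt_div (hdpos _)).2 (hdanti n.lt_succ_self))
    -- The window ratio `d n / d (n + 1)` places block n, scaled by `d (n + 1)`, in [d (n + 1) /
    -- 4^k, d n / 4^k), so the blocks follow one another in decreasing order.
    choose b hb hbmem using fun n => ih _ (hstep n)
    set p : Ordinal.{0} := ω ^ (k : Ordinal.{0}) with hp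
    have hp0 : p ≠ 0 := opow_ne_zero _ omega0_ne_zero
    have hpow : ω ^ ((k + 1 : ℕ) : Ordinal.{0}) = p * ω := by
      rw [hp, opow_natCast, opow_natCast, pow_succ]
    rw [hpow]
    have hmod : ∀ x : Ordinal.{0}, x % p ∈ Iio p := fun x => mod_lt x hp0
    have hlow : ∀ n x, (1 / 4) ^ k ≤ b n (x % p) := fun n x => (hbmem n (hmod x)).2.1
    have hup : ∀ n x, b n (x % p) < (1 / 4) ^ k * (d n / d (n + 1)) := fun n x =>
      ((hbmem n (hmod x)).2.2).trans_eq (by ring)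
    have hup' : ∀ n x, d (n + 1) * b n (x % p) < (1 / 4) ^ k * d n := fun n x =>
      calc d (n + 1) * b n (x % p) < d (n + 1) * ((1 / 4) ^ k * (d n / d (n + 1))) :=
            mul_lt_mul_of_pos_left (hup n x) (hdpos _)
        _ = (1 / 4) ^ k * d n := by have := (hdpos (n + 1)).ne'; field_simp
    have hnat : ∀ x < p * ω, ∃ n : ℕ, x / p = n := fun x hx =>
      lt_omega0.1 ((lt_mul_iff_div_lt hp0).1 hx)
    choose! q hq using hnat
    refine ⟨fun x => d (q x + 1) * b (q x) (x % p), ?_, ?_⟩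
    · intro x hx y hy hxy
      have hqle : q x ≤ q y := by
        have : x / p ≤ y / p := by
          rw [← mul_le_iff_le_div hp0]
          exact (mul_div_le x p).trans hxy.le
        rw [hq x hx, hq y hy] at this
        exact_mod_cast this
      obtain hlt | heq := hqle.lt_or_eq
      · calc d (q y + 1) * b (q y) (y % p) < (1 / 4) ^ k * d (q y) := hup' _ _
          _ ≤ (1 / 4) ^ k * d (q x + 1) := by
            gcongr
            exact hdanti.antitone hlt
          _ = d (q x + 1) * (1 / 4) ^ k := mul_comm _ _
          _ ≤ d (q x + 1) * b (q x) (x % p) := by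
            gcongr
            · exact (hdpos _).le
            · exact hlow _ _
      · simp only [← heq]
        refine mul_lt_mul_of_pos_left (hb _ (hmod x) (hmod y) ?_) (hdpos _)
        rw [← div_add_mod x p, ← div_add_mod y p, hq x hx, hq y hy, heq] at hxy
        simpa using hxy
    · intro x hx
      refine ⟨mul_mem_commProbSet (dihedralProb_mem _) (hbmem _ (hmod x)).1, ?_, ?_⟩
      · calc (1 / 4 : ℝ) ^ (k + 1) = 1 / 4 * (1 / 4) ^ k := pow_succ' _ _
          _ ≤ d (q x + 1) * b (q x) (x % p) := by
            gcongr
            · exact (hdpos _).le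
            · exact (hd0 _).le
            · exact hlow _ _
      · calc d (q x + 1) * b (q x) (x % p) < (1 / 4) ^ k * d (q x) := hup' _ _
          _ ≤ (1 / 4) ^ k * (1 / 4 * (1 + δ)) := by
            gcongr
            exact (hdanti.antitone (Nat.zero_le _)).trans hN
          _ = (1 / 4) ^ (k + 1) * (1 + δ) := by ring

theorem opow_omega0_le_type_commProbSet [IsWellOrder commProbSet (fun x y => x > y)] :
    ω ^ ω ≤ Ordinal.type (fun x y : commProbSet => x > y) := by
  refine (opow_le_of_isSuccLimit omega0_ne_zero isSuccLimit_omega0).2 fun o ho => ?_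
  obtain ⟨k, rfl⟩ := lt_omega0.1 ho
  exact ((containsDecreasing_commProbSet_near k 1 one_pos).mono inter_subset_left).le_type

end LowerBound

/-! ### Sets of reals without strictly increasing sequences -/

section ReverseWellOrdered

open Set Filter Topology
open scoped Pointwise

theorem not_wellFoundedOn_of_strictMono {A : Set ℝ} {a : ℕ → ℝ} (ha : StrictMono a)
    (hA : ∀ n, a n ∈ A) : ¬ A.WellFoundedOn (· > ·) := by
  intro h
  rw [wellFoundedOn_iff_no_descending_seq] at h
  refine h ⟨⟨a, ha.injective⟩, ?_⟩ hA
  intro m n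
  exact ha.lt_iff_lt

theorem exists_strictMono_of_not_wellFoundedOn {A : Set ℝ} (h : ¬ A.WellFoundedOn (· > ·)) :
    ∃ a : ℕ → ℝ, StrictMono a ∧ ∀ n, a n ∈ A := by
  rw [wellFoundedOn_iff_no_descending_seq] at h
  push Not at h
  obtain ⟨f, hf⟩ := h
  exact ⟨f, fun m n hmn => f.map_rel_iff.2 hmn, hf⟩

theorem wellFoundedOn_gt_iff_neg {A : Set ℝ} : A.WellFoundedOn (· > ·) ↔ (-A).IsWF := by
  rw [← image_neg_eq_neg, IsWF, wellFoundedOn_image]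
  refine iff_of_eq (congrArg _ ?_)
  ext x y
  simp [Function.onFun]

theorem wellFoundedOn_gt_add {A B : Set ℝ} (hA : A.WellFoundedOn (· > ·))
    (hB : B.WellFoundedOn (· > ·)) : (A + B).WellFoundedOn (· > ·) := by
  rw [wellFoundedOn_gt_iff_neg] at *
  rw [neg_add]
  exact hA.add hB

theorem wellFoundedOn_gt_union {A B : Set ℝ} (hA : A.WellFoundedOn (· > ·))
    (hB : B.WellFoundedOn (· > ·)) : (A ∪ B).WellFoundedOn (· > ·) := by
  rw [wellFoundedOn_gt_iff_neg] at *
  rw [union_neg]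
  exact hA.union hB

/-- For c ≥ 0 the sequence c / (n + 1) is nonincreasing; a negative numerator would give a strictly
increasing one. -/
theorem wellFoundedOn_gt_fractions {C : Set ℝ} (hC : C.Finite) (h0 : ∀ c ∈ C, 0 ≤ c) :
    (fractions C).WellFoundedOn (· > ·) := by
  rw [fractions_eq_biUnion]
  induction C, hC using Set.Finite.induction_on with
  | empty => simp
  | @insert c _ _ _ ih =>
    rw [biUnion_insert]
    refine wellFoundedOn_gt_union ?_ (ih fun c hc => h0 c (mem_insert_of_mem _ hc))
    rw [wellFoundedOn_range]
    refine Subrelation.wf (r := (· < ·)) ?_ wellFounded_lt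
    intro m n hmn
    by_contra h
    have hnm : n ≤ m := not_lt.1 h
    refine absurd hmn (not_lt.2 ?_)
    have : (0 : ℝ) ≤ c := h0 c (mem_insert _ _)
    dsimp only
    gcongr

theorem wellFoundedOn_gt_fractionSums {C : Set ℝ} (hC : C.Finite) (h0 : ∀ c ∈ C, 0 ≤ c)
    (M : ℕ) : (fractionSums C M).WellFoundedOn (· > ·) := by
  induction M with
  | zero => exact (finite_singleton _).wellFoundedOn
  | succ M ih => exact wellFoundedOn_gt_add ih (wellFoundedOn_gt_fractions hC h0)

/-- A strictly increasing sequence in `A` has a limit l, and the points of `E` below l stay away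
from l. For small δ, late terms cannot lie within δ above such a point, so a tail lies in `B`. -/
theorem wellFoundedOn_gt_of_approx {A E : Set ℝ} (hbdd : BddAbove A)
    (hE : E.WellFoundedOn (· > ·))
    (h : ∀ δ > 0, ∃ B : Set ℝ, B.WellFoundedOn (· > ·) ∧
      ∀ p ∈ A, p ∈ B ∨ ∃ q ∈ E, q ≤ p ∧ p ≤ q + δ) :
    A.WellFoundedOn (· > ·) := by
  by_contra hA
  obtain ⟨a, ha, haA⟩ := exists_strictMono_of_not_wellFoundedOn hA
  have hab : BddAbove (range a) := hbdd.mono (range_subset_iff.2 haA)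
  set l := ⨆ n, a n with hl
  have hlim : Tendsto a atTop (𝓝 l) := tendsto_atTop_ciSup ha.monotone hab
  have hlt : ∀ n, a n < l := fun n => (ha n.lt_succ_self).trans_le (le_ciSup hab (n + 1))
  have hgap : ∃ m < l, ∀ q ∈ E, q < l → q ≤ m := by
    by_cases hne : (E ∩ Iio l).Nonempty
    · have hwf : (E ∩ Iio l).WellFoundedOn (· > ·) := hE.subset inter_subset_left
      obtain ⟨q₀, -, hmin⟩ := hwf.has_min univ ⟨⟨_, hne.some_mem⟩, trivial⟩
      exact ⟨q₀, q₀.2.2, fun q hq hql => not_lt.1 (hmin ⟨q, hq, hql⟩ trivial)⟩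
    · refine ⟨l - 1, by linarith, fun q hq hql => absurd ⟨q, hq, hql⟩ hne⟩
  obtain ⟨m, hml, hm⟩ := hgap
  -- Half the gap: q ≤ m and a term at most q + δ would put that term at or below (l + m) / 2.
  obtain ⟨B, hB, hAB⟩ := h ((l - m) / 2) (by linarith)
  obtain ⟨N, hN⟩ := eventually_atTop.1
    (hlim.eventually (lt_mem_nhds (show (l + m) / 2 < l by linarith)))
  refine not_wellFoundedOn_of_strictMono (a := fun n => a (N + n))
    (fun i j hij => ha (by simpa using hij)) (fun n => ?_) hB
  refine (hAB _ (haA _)).resolve_right ?_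
  rintro ⟨q, hq, hqa, haq⟩
  have h1 := hm q hq (hqa.trans_lt (hlt _))
  have h2 := hN (N + n) (by omega)
  linarith

theorem wellFoundedOn_gt_of_inter_Ici {A : Set ℝ}
    (h : ∀ x ∈ A, (A ∩ Ici x).WellFoundedOn (· > ·)) : A.WellFoundedOn (· > ·) := by
  by_contra hA
  obtain ⟨a, ha, haA⟩ := exists_strictMono_of_not_wellFoundedOn hA
  exact not_wellFoundedOn_of_strictMono ha
    (fun n => mem_inter (haA n) (ha.monotone n.zero_le)) (h (a 0) (haA 0))

theorem isWellOrder_gt_of_wellFoundedOn {A : Set ℝ} (h : A.WellFoundedOn (· > ·)) :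
    IsWellOrder A (fun x y => x > y) where
  wf := h
  trichotomous _ _ hab hba := le_antisymm (not_lt.1 hab) (not_lt.1 hba)

theorem fractionSums_mono {C C' : Set ℝ} (hC : C ⊆ C') (M : ℕ) :
    fractionSums C M ⊆ fractionSums C' M := by
  induction M with
  | zero => exact subset_rfl
  | succ M ih => exact add_subset_add ih fun x ⟨c, hc, m, hm, hx⟩ => ⟨c, hC hc, m, hm, hx⟩

theorem fractionSums_le {C : Set ℝ} (h0 : (0 : ℝ) ∈ C) : Monotone (fractionSums C) :=
  monotone_nat_of_le_succ fun _ => subset_add_left _ (zero_mem_fractions h0)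

theorem add_mem_fractionSums {C : Set ℝ} {M : ℕ} {x : ℝ} (hx : x ∈ fractionSums C M) (N : ℕ)
    {y : ℝ} (hy : y ∈ fractionSums C N) : x + y ∈ fractionSums C (M + N) := by
  induction N generalizing y with
  | zero =>
    rw [fractionSums, mem_singleton_iff] at hy
    simpa [hy] using hx
  | succ N ih =>
    obtain ⟨y, hy, z, hz, rfl⟩ := hy
    change x + (y + z) ∈ fractionSums C (M + N + 1)
    rw [← add_assoc x y z]
    exact Set.add_mem_add (ih hy) hz

theorem sum_mem_fractionSums {C : Set ℝ} {M : ℕ} {ι : Type*} (s : Finset ι) {f : ι → ℝ}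
    (hf : ∀ i ∈ s, f i ∈ fractionSums C M) : ∑ i ∈ s, f i ∈ fractionSums C (s.card * M) := by
  classical
  induction s using Finset.induction_on with
  | empty => simp [fractionSums]
  | insert i s hi ih =>
    rw [Finset.sum_insert hi, Finset.card_insert_of_notMem hi, Nat.succ_mul, add_comm (_ * _)]
    exact add_mem_fractionSums (hf i (Finset.mem_insert_self _ _)) _
      (ih fun j hj => hf j (Finset.mem_insert_of_mem hj))

theorem fractions_subset_fractionSums_one (C : Set ℝ) : fractions C = fractionSums C 1 := by
  simp [fractionSums]

end ReverseWellOrdered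

/-! ### Averages of quadratic phases -/

section QuadraticPhase

/-- Averages of at most `D` complex `e`-th roots of unity. -/
def rootAverages (e D : ℕ) : Set ℂ :=
  {z | ∃ k, 0 < k ∧ k ≤ D ∧ ∃ ζ : Fin k → ℂ, (∀ i, ζ i ^ e = 1) ∧ z = (∑ i, ζ i) / k}

theorem card_filter_mk_eq {G : Type*} [Group G] [Fintype G] (N : Subgroup G)
    (q : G ⧸ N) [DecidablePred fun x : G => (x : G ⧸ N) = q] :
    (Finset.univ.filter fun x : G => (x : G ⧸ N) = q).card = Nat.card N := by
  rw [← Fintype.card_subtype, ← Nat.card_eq_fintype_card]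
  have := Nat.card_congr (QuotientGroup.preimageMkEquivSubgroupProdSet N {q})
  rw [Nat.card_prod, Nat.card_unique (α := ({q} : Set _)), mul_one] at this
  rw [← this]
  exact Nat.card_congr (Equiv.subtypeEquivRight (by simp))

theorem finite_rootAverages {e : ℕ} (he : 0 < e) (D : ℕ) : (rootAverages e D).Finite := by
  have hroots : {z : ℂ | z ^ e = 1}.Finite := by
    refine (Polynomial.nthRootsFinset e (1 : ℂ)).finite_toSet.subset fun z hz => ?_
    simpa [Polynomial.mem_nthRootsFinset he] using hz
  have h : ∀ k : ℕ, ((fun ζ : Fin k → ℂ => (∑ i, ζ i) / (k : ℂ)) ''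
      Set.pi Set.univ fun _ => {z : ℂ | z ^ e = 1}).Finite := fun k =>
    (Set.Finite.pi' fun _ => hroots).image _ |>.subset (Set.image_mono fun ζ hζ i => hζ i trivial)
  refine ((Set.finite_Iic D).biUnion fun k _ => h k).subset ?_
  rintro z ⟨k, -, hk, ζ, hζ, rfl⟩
  exact Set.mem_biUnion (Set.mem_Iic.2 hk) ⟨ζ, fun i _ => hζ i, rfl⟩

variable {A : Type*} [CommGroup A] {e : ℕ} {f : A → ℂˣ} {β : A →* A →* ℂˣ}

theorem phase_one (hf : ∀ x y, f (x * y) = f x * f y * β x y) : f 1 = 1 := by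
  simpa using hf 1 1

theorem bilin_pow_eq_one (hf : ∀ x y, f (x * y) = f x * f y * β x y) (he : ∀ x, f x ^ e = 1)
    (x y : A) : β x y ^ e = 1 := by
  have := congrArg (· ^ e) (hf x y)
  simpa [mul_pow, he] using this.symm

theorem bilin_symm (hf : ∀ x y, f (x * y) = f x * f y * β x y) (x y : A) : β x y = β y x := by
  have h := hf x y
  rw [mul_comm x y, hf y x, mul_comm (f y)] at h
  exact (mul_left_cancel h).symm

theorem phase_prod (hf : ∀ x y, f (x * y) = f x * f y * β x y) (S : Finset A)
    (hS : ∀ x ∈ S, ∀ y ∈ S, x ≠ y → β x y = 1) : f (∏ x ∈ S, x) = ∏ x ∈ S, f x := by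
  classical
  induction S using Finset.induction_on with
  | empty => simpa using phase_one hf
  | insert a S ha ih =>
    rw [Finset.prod_insert ha, Finset.prod_insert ha, hf, ih, map_prod,
      Finset.prod_eq_one (f := fun x => β a x), mul_one]
    · intro x hx
      exact hS a (Finset.mem_insert_self _ _) x (Finset.mem_insert_of_mem hx)
        (fun h => ha (h ▸ hx))
    · exact fun x hx y hy => hS x (Finset.mem_insert_of_mem hx) y (Finset.mem_insert_of_mem hy)

theorem bilin_prod (S : Finset A) (hS : ∀ x ∈ S, ∀ y ∈ S, x ≠ y → β x y = 1) :
    β (∏ x ∈ S, x) (∏ x ∈ S, x) = ∏ x ∈ S, β x x := by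
  rw [map_prod (β (∏ x ∈ S, x))]
  refine Finset.prod_congr rfl fun x hx => ?_
  rw [map_prod, MonoidHom.finsetProd_apply, Finset.prod_eq_single_of_mem x hx]
  exact fun y hy hyx => hS y hy x hx hyx

theorem phase_pow (hf : ∀ x y, f (x * y) = f x * f y * β x y) {y : A} (h1 : f y = 1)
    (h2 : β y y = 1) (n : ℕ) : f (y ^ n) = 1 := by
  induction n with
  | zero => simpa using phase_one hf
  | succ n ih => rw [pow_succ, hf, ih, h1, map_pow, MonoidHom.pow_apply, h2]; simp

/-- The elements of `A` orthogonal to the subgroup `I`. -/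
def orthogonal (β : A →* A →* ℂˣ) (I : Subgroup A) : Subgroup A where
  carrier := {x | ∀ i ∈ I, β x i = 1}
  one_mem' := by simp
  mul_mem' := fun hx hy i hi => by simp [hx i hi, hy i hi]
  inv_mem' := fun hx i hi => by simp [hx i hi]

theorem le_orthogonal_of_isotropic (hf : ∀ x y, f (x * y) = f x * f y * β x y) {I : Subgroup A}
    (hI : ∀ x ∈ I, f x = 1) : I ≤ orthogonal β I := by
  intro x hx i hi
  have := hf x i
  simpa [hI x hx, hI i hi, hI _ (I.mul_mem hx hi)] using this.symm

/-- Inside the orthogonal of `I` the cross term with `I` vanishes, so f is constant on cosets of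
`I`. -/
theorem sum_eq_card_mul_sum_quotient (hf : ∀ x y, f (x * y) = f x * f y * β x y)
    {I J : Subgroup A} (hI : ∀ x ∈ I, f x = 1) (hIJ : I ≤ J) (hJ : J ≤ orthogonal β I)
    [Fintype J] [Fintype (J ⧸ I.subgroupOf J)] :
    ∑ x : J, (f x : ℂ) = Nat.card I * ∑ q : J ⧸ I.subgroupOf J, (f (q.out : J) : ℂ) := by
  classical
  have hcard : Nat.card (I.subgroupOf J) = Nat.card I :=
    Nat.card_congr (Subgroup.subgroupOfEquivOfLe hIJ).toEquiv
  rw [← Finset.sum_fiberwise (s := Finset.univ)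
    (g := fun x : J => (x : J ⧸ I.subgroupOf J)), Finset.mul_sum]
  refine Finset.sum_congr rfl fun q _ => ?_
  have hconst : ∀ x ∈ Finset.univ.filter (fun x : J => (x : J ⧸ I.subgroupOf J) = q),
      (f x : ℂ) = f (q.out : J) := by
    intro x hx
    have hx' : ((q.out : J) : J ⧸ I.subgroupOf J) = x := by
      rw [(Finset.mem_filter.1 hx).2]
      exact QuotientGroup.out_eq' q
    have hmem : ((q.out : J) : A)⁻¹ * x ∈ I := by
      have := QuotientGroup.eq.1 hx'
      rwa [Subgroup.mem_subgroupOf] at this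
    have : f x = f (q.out : J) := by
      conv_lhs => rw [← mul_inv_cancel_left ((q.out : J) : A) (x : A)]
      rw [hf, hI _ hmem, hJ (q.out : J).2 _ hmem]
      simp
    rw [this]
  rw [Finset.sum_congr rfl hconst, Finset.sum_const, nsmul_eq_mul]
  congr 2
  rw [← hcard, card_filter_mk_eq]

variable [Finite A]

/-- A subgroup that is maximal among those on which the quadratic phase vanishes. -/
theorem exists_maximal_isotropic (hf : ∀ x y, f (x * y) = f x * f y * β x y) :
    ∃ I : Subgroup A, Maximal (fun I : Subgroup A => ∀ x ∈ I, f x = 1) I := by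
  have := (Set.toFinite {I : Subgroup A | ∀ x ∈ I, f x = 1}).exists_maximal
    ⟨⊥, by simpa using phase_one hf⟩
  simpa using this

/-- Otherwise adjoining y would enlarge `I`: cross terms vanish by orthogonality, and f is trivial
on powers of y. -/
theorem mem_of_maximal_isotropic (hf : ∀ x y, f (x * y) = f x * f y * β x y) {I : Subgroup A}
    (hI : Maximal (fun I : Subgroup A => ∀ x ∈ I, f x = 1) I) {y : A} (hy : y ∈ orthogonal β I)
    (h1 : f y = 1) (h2 : β y y = 1) : y ∈ I := by
  have hle : I ⊔ Subgroup.zpowers y ≤ I := by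
    refine hI.2 ?_ le_sup_left
    intro x hx
    obtain ⟨i, hi, z, hz, rfl⟩ := Subgroup.mem_sup.1 hx
    -- As `A` is finite, natural exponents suffice.
    obtain ⟨n, rfl⟩ := (mem_powers_iff_mem_zpowers).2 hz
    have : β i (y ^ n) = 1 := by rw [map_pow, bilin_symm hf, hy i hi, one_pow]
    change f (i * y ^ n) = 1
    rw [hf, hI.1 i hi, phase_pow hf h1 h2, this]
    simp
  exact hle (Subgroup.mem_sup_right (Subgroup.mem_zpowers y))

/-- Orthogonality to one element is the kernel of a character into the e-th roots of unity, so each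
condition costs a factor of at most e. -/
theorem card_le_orthogonal_inf [NeZero e] (hf : ∀ x y, f (x * y) = f x * f y * β x y)
    (he : ∀ x, f x ^ e = 1) (J : Subgroup A) (T : Finset A) :
    ∃ P : Subgroup A, P ≤ J ∧ (∀ x ∈ P, ∀ t ∈ T, β x t = 1) ∧
      Nat.card J ≤ e ^ T.card * Nat.card P := by
  let φ : J →* (T → rootsOfUnity e ℂ) :=
    { toFun := fun x t => ⟨β x t, (mem_rootsOfUnity _ _).2 (bilin_pow_eq_one hf he _ _)⟩
      map_one' := by ext; simp
      map_mul' := fun x y => by ext; simp }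
  refine ⟨φ.ker.map J.subtype, Subgroup.map_subtype_le _, ?_, ?_⟩
  · rintro _ ⟨x, hx, rfl⟩ t ht
    have := congrFun (MonoidHom.mem_ker.1 hx) ⟨t, ht⟩
    exact congrArg Subtype.val this
  · rw [Subgroup.card_map_of_injective J.subtype_injective, ← φ.ker.index_mul_card,
      Subgroup.index_ker]
    gcongr
    calc Nat.card φ.range ≤ Nat.card (T → rootsOfUnity e ℂ) :=
          Nat.card_le_card_of_injective _ Subtype.val_injective
      _ = e ^ T.card := by
        rw [Nat.card_fun, Complex.card_rootsOfUnity, Nat.card_eq_fintype_card, Fintype.card_coe]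

/-- A greedy choice. The elements of `J` orthogonal to r chosen ones number at least |J| / e^r,
while `T` and the translates of `I` by inverse subset products rule out at most 4^r |I| of them;
hence the constant 4e. -/
theorem exists_orthogonal_finset [NeZero e] (hf : ∀ x y, f (x * y) = f x * f y * β x y)
    (he : ∀ x, f x ^ e = 1) {I J : Subgroup A} {R : ℕ}
    (hIJ : (4 * e) ^ R * Nat.card I < Nat.card J) :
    ∀ r ≤ R, ∃ T : Finset A, T.card = r ∧ (∀ x ∈ T, x ∈ J) ∧
      (∀ x ∈ T, ∀ y ∈ T, x ≠ y → β x y = 1) ∧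
      ∀ S ⊆ T, S.Nonempty → ∏ x ∈ S, x ∉ I := by
  classical
  intro r
  induction r with
  | zero => exact fun _ => ⟨∅, by simp⟩
  | succ r ih =>
    intro hr
    obtain ⟨T, hTr, hTJ, hTo, hTI⟩ := ih (by omega)
    obtain ⟨P, hPJ, hPT, hPcard⟩ := card_le_orthogonal_inf hf he J T
    have hIfin : (I : Set A).Finite := Set.toFinite _
    set B : Finset A := T.powerset.biUnion fun S => hIfin.toFinset.image fun i => (∏ x ∈ S, x)⁻¹ * i
      with hB
    have hIpos : 0 < Nat.card I := Nat.card_pos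
    have hBcard : B.card ≤ 2 ^ r * Nat.card I := by
      rw [← hTr, ← Finset.card_powerset]
      refine Finset.card_biUnion_le_card_mul _ _ _ fun S _ => Finset.card_image_le.trans ?_
      rw [← Set.ncard_eq_toFinset_card _ hIfin]
      exact le_rfl
    have hPfin : (P : Set A).Finite := Set.toFinite _
    have hBT : (B ∪ T).card ≤ 4 ^ r * Nat.card I := by
      have h1 : r < 2 ^ r := Nat.lt_two_pow_self
      have h2 : 4 ^ r = 2 ^ r * 2 ^ r := by rw [← mul_pow]; norm_num
      calc (B ∪ T).card ≤ B.card + T.card := Finset.card_union_le _ _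
        _ ≤ 2 ^ r * Nat.card I + (2 ^ r - 1) * Nat.card I := by
          gcongr
          rw [hTr]
          exact (Nat.le_sub_one_of_lt h1).trans (Nat.le_mul_of_pos_right _ hIpos)
        _ = (2 ^ r + (2 ^ r - 1)) * Nat.card I := (add_mul _ _ _).symm
        _ ≤ 4 ^ r * Nat.card I := by
          gcongr
          rw [h2]
          obtain rfl | hr0 := Nat.eq_zero_or_pos r
          · simp
          · have : 2 ≤ 2 ^ r := Nat.le_self_pow hr0.ne' 2
            nlinarith [Nat.sub_le (2 ^ r) 1]
    have hlt : (B ∪ T).card < hPfin.toFinset.card := by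
      rw [← Set.ncard_eq_toFinset_card _ hPfin]
      change _ < Nat.card P
      refine hBT.trans_lt ?_
      have he0 : 0 < e := Nat.pos_of_ne_zero (NeZero.ne e)
      have h1 : (4 * e) ^ r ≤ (4 * e) ^ R := Nat.pow_le_pow_right (by omega) (by omega)
      have h2 : (4 * e) ^ r * Nat.card I < e ^ r * Nat.card P := by
        calc _ ≤ (4 * e) ^ R * Nat.card I := by gcongr
          _ < Nat.card J := hIJ
          _ ≤ _ := hTr ▸ hPcard
      rw [mul_pow, mul_comm (4 ^ r), mul_assoc] at h2
      exact lt_of_mul_lt_mul_left' h2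
    obtain ⟨x, hxP, hxB⟩ := Finset.exists_mem_notMem_of_card_lt_card hlt
    rw [Set.Finite.mem_toFinset] at hxP
    rw [Finset.mem_union, not_or] at hxB
    obtain ⟨hxB, hxT⟩ := hxB
    have hx : ∀ S ⊆ T, (∏ y ∈ S, y) * x ∉ I := by
      intro S hS hI
      refine hxB (Finset.mem_biUnion.2 ⟨S, Finset.mem_powerset.2 hS,
        Finset.mem_image.2 ⟨_, hIfin.mem_toFinset.2 hI, by simp⟩⟩)
    refine ⟨insert x T, by rw [Finset.card_insert_of_notMem hxT, hTr], ?_, ?_, ?_⟩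
    · simpa using ⟨hPJ hxP, hTJ⟩
    · intro a ha b hb hab
      rw [Finset.mem_insert] at ha hb
      obtain rfl | ha := ha <;> obtain rfl | hb := hb
      · exact absurd rfl hab
      · exact hPT _ hxP _ hb
      · rw [bilin_symm hf]
        exact hPT _ hxP _ ha
      · exact hTo a ha b hb hab
    · intro S hS hne
      by_cases hxS : x ∈ S
      · rw [← Finset.prod_erase_mul _ _ hxS]
        exact hx _ (Finset.subset_insert_iff.1 hS)
      · exact hTI S ((Finset.subset_insert_iff_of_notMem hxS).1 hS) hne

/-- Otherwise there are e^3 pairwise orthogonal elements. The pair (f x, β x x) takes at most e^2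
values, so e of them share it. Their product then has both values equal to an e-th power of an e-th
root of unity, hence 1, so maximality puts it in `I`, a contradiction. -/
theorem card_orthogonal_le [NeZero e] (hf : ∀ x y, f (x * y) = f x * f y * β x y)
    (he : ∀ x, f x ^ e = 1) {I : Subgroup A}
    (hI : Maximal (fun I : Subgroup A => ∀ x ∈ I, f x = 1) I) :
    Nat.card (orthogonal β I) ≤ (4 * e) ^ e ^ 3 * Nat.card I := by
  classical
  by_contra! h
  obtain ⟨T, hTcard, hTJ, hTo, hTI⟩ := exists_orthogonal_finset hf he h _ le_rfl
  have he0 : 0 < e := Nat.pos_of_ne_zero (NeZero.ne e)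
  have := Fintype.ofFinite (rootsOfUnity e ℂ)
  let φ : A → rootsOfUnity e ℂ × rootsOfUnity e ℂ := fun x =>
    (⟨f x, (mem_rootsOfUnity _ _).2 (he x)⟩,
      ⟨β x x, (mem_rootsOfUnity _ _).2 (bilin_pow_eq_one hf he x x)⟩)
  obtain ⟨v, -, hv⟩ := Finset.exists_le_card_fiber_of_mul_le_card_of_maps_to (s := T)
    (t := Finset.univ) (f := φ) (n := e) (fun _ _ => Finset.mem_univ _) Finset.univ_nonempty (by
      rw [Finset.card_univ, Fintype.card_prod, ← Nat.card_eq_fintype_card,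
        Complex.card_rootsOfUnity, hTcard]
      exact (by ring : e * e * e = e ^ 3).le)
  obtain ⟨S, hSv, hScard⟩ := Finset.exists_subset_card_eq hv
  have hST : S ⊆ T := hSv.trans (Finset.filter_subset _ _)
  have hSo : ∀ x ∈ S, ∀ y ∈ S, x ≠ y → β x y = 1 := fun x hx y hy => hTo x (hST hx) y (hST hy)
  have hSφ : ∀ x ∈ S, φ x = v := fun x hx => (Finset.mem_filter.1 (hSv hx)).2
  have hSne : S.Nonempty := Finset.card_pos.1 (by omega)
  refine hTI S hST hSne (mem_of_maximal_isotropic hf hI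
    (Subgroup.prod_mem _ fun x hx => hTJ x (hST hx)) ?_ ?_)
  · rw [phase_prod hf S hSo]
    have : ∀ x ∈ S, f x = v.1 := fun x hx => congrArg (fun w => (w.1 : ℂˣ)) (hSφ x hx)
    rw [Finset.prod_congr rfl this, Finset.prod_const, hScard]
    exact (mem_rootsOfUnity _ _).1 v.1.2
  · rw [bilin_prod S hSo]
    have : ∀ x ∈ S, β x x = v.2 := fun x hx => congrArg (fun w => (w.2 : ℂˣ)) (hSφ x hx)
    rw [Finset.prod_congr rfl this, Finset.prod_const, hScard]
    exact (mem_rootsOfUnity _ _).1 v.2.2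

/-- Translating by i in `I` multiplies the summand by `β x i`; averaging over `I` kills every x
outside the orthogonal. -/
theorem sum_phase_eq_sum_orthogonal [Fintype A] (hf : ∀ x y, f (x * y) = f x * f y * β x y)
    {I : Subgroup A} (hI : ∀ x ∈ I, f x = 1) [Fintype (orthogonal β I)] :
    ∑ x, (f x : ℂ) = ∑ x : orthogonal β I, (f x : ℂ) := by
  classical
  have := Fintype.ofFinite I
  have hcard : (Fintype.card I : ℂ) ≠ 0 := Nat.cast_ne_zero.2 Fintype.card_ne_zero
  refine mul_left_cancel₀ hcard ?_
  have hshift : ∀ i : I, ∑ x, (f x : ℂ) = ∑ x, (f x : ℂ) * (β x i : ℂ) := fun i => by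
    rw [← Equiv.sum_comp (Equiv.mulRight (i : A))]
    refine Finset.sum_congr rfl fun x _ => ?_
    rw [Equiv.coe_mulRight, hf, hI i i.2, mul_one, Units.val_mul]
  have hinner : ∀ x,
      ∑ i : I, (β x i : ℂ) = if x ∈ orthogonal β I then (Fintype.card I : ℂ) else 0 := by
    intro x
    have := sum_hom_units ((Units.coeHom ℂ).comp ((β x).comp I.subtype))
    refine Eq.trans (by rfl) (this.trans ?_)
    push_cast
    refine if_congr ⟨fun h i hi => ?_, fun h => ?_⟩ rfl rfl
    · exact Units.ext (DFunLike.congr_fun h (⟨i, hi⟩ : I))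
    · ext i
      exact congrArg Units.val (h i i.2)
  calc (Fintype.card I : ℂ) * ∑ x, (f x : ℂ) = ∑ i : I, ∑ x, (f x : ℂ) * (β x i : ℂ) := by
        rw [← Finset.sum_congr rfl fun i _ => hshift i, Finset.sum_const, Finset.card_univ,
          nsmul_eq_mul]
    _ = ∑ x, (f x : ℂ) * ∑ i : I, (β x i : ℂ) := by
        rw [Finset.sum_comm]
        simp_rw [Finset.mul_sum]
    _ = (Fintype.card I : ℂ) * ∑ x : orthogonal β I, (f x : ℂ) := by
        simp_rw [hinner, mul_ite, mul_zero, ← Finset.sum_filter,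
          mul_comm (_ : ℂ) (Fintype.card I : ℂ), ← Finset.mul_sum]
        congr 1
        exact Finset.sum_subtype _ (by simp) _

/-- With J the orthogonal of a maximal isotropic I, the mean is the average over the bounded
quotient J / I, divided by the index of J. -/
theorem exists_sum_phase_eq [Fintype A] [NeZero e]
    (hf : ∀ x y, f (x * y) = f x * f y * β x y) (he : ∀ x, f x ^ e = 1) :
    ∃ c ∈ rootAverages e ((4 * e) ^ e ^ 3), ∃ m : ℕ, 0 < m ∧
      (∑ x, (f x : ℂ)) / Nat.card A = c / m := by
  classical
  obtain ⟨I, hI⟩ := exists_maximal_isotropic hf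
  have hIJ := le_orthogonal_of_isotropic hf hI.1
  set J := orthogonal β I with hJ
  have := Fintype.ofFinite J
  have := Fintype.ofFinite (J ⧸ I.subgroupOf J)
  have hsum : ∑ x, (f x : ℂ) = Nat.card I * ∑ q : J ⧸ I.subgroupOf J, (f (q.out : J) : ℂ) :=
    (sum_phase_eq_sum_orthogonal hf hI.1).trans
      (sum_eq_card_mul_sum_quotient hf hI.1 hIJ hJ.le)
  set k := Nat.card (J ⧸ I.subgroupOf J) with hk
  have hkpos : 0 < k := Nat.card_pos
  have hkI : k * Nat.card I = Nat.card J := by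
    rw [← Nat.card_congr (Subgroup.subgroupOfEquivOfLe hIJ).toEquiv]
    exact (Subgroup.card_eq_card_quotient_mul_card_subgroup _).symm
  have hIpos : 0 < Nat.card I := Nat.card_pos
  have hkle : k ≤ (4 * e) ^ e ^ 3 :=
    le_of_mul_le_mul_right (hkI.trans_le (card_orthogonal_le hf he hI)) hIpos
  let E : Fin k ≃ J ⧸ I.subgroupOf J := (Finite.equivFin _).symm
  refine ⟨(∑ q : J ⧸ I.subgroupOf J, (f (q.out : J) : ℂ)) / k, ⟨k, hkpos, hkle,
    fun i => f ((E i).out : J), fun i => ?_, ?_⟩, J.index,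
    Nat.pos_of_ne_zero J.index_ne_zero_of_finite, ?_⟩
  · rw [← Units.val_pow_eq_pow_val, he, Units.val_one]
  · rw [← Equiv.sum_comp E]
  · rw [hsum, ← J.card_mul_index, ← hkI]
    have h1 : (k : ℂ) ≠ 0 := Nat.cast_ne_zero.2 hkpos.ne'
    have h2 : (Nat.card I : ℂ) ≠ 0 := Nat.cast_ne_zero.2 hIpos.ne'
    have h3 : (J.index : ℂ) ≠ 0 := Nat.cast_ne_zero.2 J.index_ne_zero_of_finite
    push_cast
    field_simp

/-- A quadratic phase on a finite group is constant along the commutator subgroup or has mean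
zero, so its mean is governed by the abelian case. -/
theorem exists_sum_phase_eq_of_group {L : Type*} [Group L] [Fintype L] [NeZero e] {f : L → ℂˣ}
    {β : L →* L →* ℂˣ} (hf : ∀ x y, f (x * y) = f x * f y * β x y) (he : ∀ x, f x ^ e = 1) :
    ∃ c ∈ insert 0 (rootAverages e ((4 * e) ^ e ^ 3)), ∃ m : ℕ, 0 < m ∧
      (∑ x, (f x : ℂ)) / Nat.card L = c / m := by
  classical
  have hβl : ∀ z ∈ commutator L, ∀ x, β z x = 1 := fun z hz x => by
    rw [MonoidHom.mem_ker.1 (Abelianization.commutator_subset_ker β hz), MonoidHom.one_apply]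
  have hβr : ∀ z ∈ commutator L, ∀ x, β x z = 1 := fun z hz x =>
    MonoidHom.mem_ker.1 (Abelianization.commutator_subset_ker (β x) hz)
  by_cases hz : ∀ z ∈ commutator L, f z = 1
  swap
  · push Not at hz
    obtain ⟨z, hz, hfz⟩ := hz
    refine ⟨0, Set.mem_insert _ _, 1, one_pos, ?_⟩
    have h : ∑ x, (f x : ℂ) = f z * ∑ x, (f x : ℂ) := by
      conv_lhs => rw [← Equiv.sum_comp (Equiv.mulLeft z)]
      rw [Finset.mul_sum]
      refine Finset.sum_congr rfl fun x _ => ?_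
      rw [Equiv.coe_mulLeft, hf, hβl z hz, mul_one, Units.val_mul]
    have h0 : ∑ x, (f x : ℂ) = 0 := by
      by_contra hne
      exact hfz (Units.ext (mul_right_cancel₀ hne (by simpa using h.symm)))
    simp [h0]
  · let g : Abelianization L → ℂˣ := fun a => f a.out
    have hg : ∀ x : L, g (Abelianization.of x) = f x := by
      intro x
      have hmem : (Quotient.out (Abelianization.of x))⁻¹ * x ∈ commutator L :=
        QuotientGroup.eq.1 (QuotientGroup.out_eq' (Abelianization.of x))
      conv_rhs => rw [← mul_inv_cancel_left (Quotient.out (Abelianization.of x)) x]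
      rw [hf, hz _ hmem, hβr _ hmem, mul_one, mul_one]
    let γ : Abelianization L →* Abelianization L →* ℂˣ :=
      Abelianization.lift (MonoidHom.mk' (fun x => Abelianization.lift (β x)) fun x y => by
        ext z
        simp)
    have hγ : ∀ x y, γ (Abelianization.of x) (Abelianization.of y) = β x y := fun x y => by
      simp [γ]
    have := Fintype.ofFinite (Abelianization L)
    obtain ⟨c, hc, m, hm, hcm⟩ := exists_sum_phase_eq (f := g) (β := γ) (e := e)
      (by
        intro a b
        obtain ⟨x, rfl⟩ := QuotientGroup.mk_surjective a
        obtain ⟨y, rfl⟩ := QuotientGroup.mk_surjective b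
        change g (Abelianization.of x * Abelianization.of y) = g (Abelianization.of x) *
          g (Abelianization.of y) * γ (Abelianization.of x) (Abelianization.of y)
        rw [← map_mul, hg, hg, hg, hγ, hf])
      (fun a => he _)
    refine ⟨c, Set.mem_insert_of_mem _ hc, m, hm, ?_⟩
    rw [← hcm, (commutator L).card_eq_card_quotient_mul_card_subgroup]
    have hsum : ∑ x, (f x : ℂ) = Nat.card (commutator L) * ∑ a, (g a : ℂ) := by
      rw [← Finset.sum_fiberwise (s := Finset.univ) (g := fun x : L => Abelianization.of x),
        Finset.mul_sum]
      refine Finset.sum_congr rfl fun a _ => ?_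
      have hconst : ∀ x ∈ Finset.univ.filter (fun x : L => Abelianization.of x = a),
          (f x : ℂ) = g a := by
        intro x hx
        rw [← (Finset.mem_filter.1 hx).2, hg]
      rw [Finset.sum_congr rfl hconst, Finset.sum_const, nsmul_eq_mul]
      congr 2
      exact card_filter_mk_eq (commutator L) a
    rw [hsum]
    have h2 : (Nat.card (commutator L) : ℂ) ≠ 0 := Nat.cast_ne_zero.2 Nat.card_pos.ne'
    push_cast
    rw [mul_comm, mul_div_mul_right _ _ h2]
    rfl

end QuadraticPhase

/-! ### Twisted commuting pairs in groups of class two -/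

section ClassTwo

open scoped commutatorElement

theorem sum_monoidHom_units_eq {K : Type*} [CommGroup K] [Finite K] [Fintype (K →* ℂˣ)]
    [DecidableEq K] (a : K) :
    ∑ χ : K →* ℂˣ, (χ a : ℂ) = if a = 1 then (Nat.card K : ℂ) else 0 := by
  split_ifs with ha
  · rw [ha, ← CommGroup.card_monoidHom_of_hasEnoughRootsOfUnity K ℂ]
    simp [Nat.card_eq_fintype_card]
  · obtain ⟨χ₀, hχ₀⟩ := CommGroup.exists_apply_ne_one_of_hasEnoughRootsOfUnity K ℂ ha
    have h : ∑ χ : K →* ℂˣ, (χ a : ℂ) = χ₀ a * ∑ χ : K →* ℂˣ, (χ a : ℂ) := by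
      conv_lhs => rw [← Equiv.sum_comp (Equiv.mulLeft χ₀)]
      rw [Finset.mul_sum]
      exact Finset.sum_congr rfl fun χ _ => by simp
    by_contra hne
    exact hχ₀ (Units.ext (mul_right_cancel₀ hne (by simpa using h.symm)))

variable {H : Type*} [Group H]

/-- A central subgroup is commutative. -/
abbrev commGroupOfLeCenter {K : Subgroup H} (hK : K ≤ Subgroup.center H) : CommGroup K :=
  { (inferInstance : Group K) with
    mul_comm := fun x y => Subtype.ext ((Subgroup.mem_center_iff.1 (hK y.2) x)) }

theorem mul_comm_of_mem_commutator (hH : commutator H ≤ Subgroup.center H) {z : H}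
    (hz : z ∈ commutator H) (x : H) : z * x = x * z :=
  (Subgroup.mem_center_iff.1 (hH hz) x).symm

theorem commutatorElement_mem (x y : H) : ⁅x, y⁆ ∈ commutator H :=
  Subgroup.commutator_mem_commutator (Subgroup.mem_top x) (Subgroup.mem_top y)

theorem commutatorElement_mul_left (hH : commutator H ≤ Subgroup.center H) (x y z : H) :
    ⁅x * y, z⁆ = ⁅x, z⁆ * ⁅y, z⁆ := by
  have h := mul_comm_of_mem_commutator hH (commutatorElement_mem y z) (z * x⁻¹ * z⁻¹)
  calc ⁅x * y, z⁆ = x * (⁅y, z⁆ * (z * x⁻¹ * z⁻¹)) := by simp only [commutatorElement_def]; group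
    _ = x * (z * x⁻¹ * z⁻¹ * ⁅y, z⁆) := by rw [h]
    _ = _ := by simp only [commutatorElement_def]; group

theorem commutatorElement_mul_right (hH : commutator H ≤ Subgroup.center H) (x y z : H) :
    ⁅x, y * z⁆ = ⁅x, y⁆ * ⁅x, z⁆ := by
  rw [← commutatorElement_inv, commutatorElement_mul_left hH, mul_inv_rev, commutatorElement_inv,
    commutatorElement_inv, mul_comm_of_mem_commutator hH (commutatorElement_mem x z)]

/-- The commutator pairing of a group of class two. -/
def commutatorPairing (hH : commutator H ≤ Subgroup.center H) :
    letI := commGroupOfLeCenter hH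
    H →* H →* commutator H :=
  letI := commGroupOfLeCenter hH
  MonoidHom.mk' (fun x => MonoidHom.mk' (fun y => ⟨⁅x, y⁆, commutatorElement_mem x y⟩)
    fun y z => Subtype.ext (commutatorElement_mul_right hH x y z))
    fun x y => MonoidHom.ext fun z => Subtype.ext (commutatorElement_mul_left hH x y z)

theorem commutatorElement_inv_inv (hH : commutator H ≤ Subgroup.center H) (x y : H) :
    ⁅x⁻¹, y⁻¹⁆ = ⁅x, y⁆ := by
  let := commGroupOfLeCenter hH
  have h : commutatorPairing hH x⁻¹ y⁻¹ = commutatorPairing hH x y := by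
    rw [map_inv, map_inv, MonoidHom.inv_apply, inv_inv]
  exact congrArg Subtype.val h

/-- The twisted commutator whose vanishing expresses that two elements of given cosets commute. -/
def twistedCommutator (a c : H →* H) (p : H × H) : H :=
  c p.1 * p.2 * p.1⁻¹ * (a p.2)⁻¹

/-- The pairs whose twisted commutator lies in the commutator subgroup. -/
def twistedKer (a c : H →* H) : Subgroup (H × H) :=
  MonoidHom.ker ((Abelianization.of.comp (c.comp (MonoidHom.fst H H))) *
    (Abelianization.of.comp (MonoidHom.snd H H)) *
    (Abelianization.of.comp (MonoidHom.fst H H))⁻¹ *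
    (Abelianization.of.comp (a.comp (MonoidHom.snd H H)))⁻¹)

theorem mem_twistedKer {a c : H →* H} {p : H × H} :
    p ∈ twistedKer a c ↔ twistedCommutator a c p ∈ commutator H := by
  rw [twistedKer, MonoidHom.mem_ker, ← Abelianization.ker_of, MonoidHom.mem_ker]
  simp [twistedCommutator]

/-- The defect from multiplicativity is bilinear in p and q, so composing with a character gives a
quadratic phase. Only the value at q is moved past other factors, so only q has to lie in the
kernel. -/
theorem twistedCommutator_mul (hH : commutator H ≤ Subgroup.center H) (a c : H →* H)
    {p q : H × H} (hq : q ∈ twistedKer a c) :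
    twistedCommutator a c (p * q) =
      twistedCommutator a c p * twistedCommutator a c q * (⁅p.2, c q.1⁆⁻¹ * ⁅p.1, a q.2⁆) := by
  rw [commutatorElement_inv, ← commutatorElement_inv_inv hH p.1]
  obtain ⟨x, y⟩ := p
  obtain ⟨u, v⟩ := q
  rw [mem_twistedKer] at hq
  simp only [twistedCommutator, Prod.mk_mul_mk, map_mul, mul_inv_rev] at hq ⊢
  set k₁ := ⁅c u, y⁆ with hk₁
  set k₂ := ⁅x⁻¹, (a v)⁻¹⁆ with hk₂
  have h₁ := mul_comm_of_mem_commutator hH (commutatorElement_mem (c u) y)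
  have h₂ := mul_comm_of_mem_commutator hH (commutatorElement_mem x⁻¹ (a v)⁻¹)
  have h₃ := mul_comm_of_mem_commutator hH hq
  have e₁ : c u * y = k₁ * (y * c u) := by rw [hk₁, commutatorElement_def]; group
  have e₂ : x⁻¹ * (a v)⁻¹ = k₂ * ((a v)⁻¹ * x⁻¹) := by rw [hk₂, commutatorElement_def]; group
  calc c x * c u * (y * v) * (u⁻¹ * x⁻¹) * ((a v)⁻¹ * (a y)⁻¹)
      = c x * (c u * y) * v * u⁻¹ * (x⁻¹ * (a v)⁻¹) * (a y)⁻¹ := by group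
    _ = c x * (k₁ * (y * c u)) * v * u⁻¹ * (k₂ * ((a v)⁻¹ * x⁻¹)) * (a y)⁻¹ := by rw [e₁, e₂]
    _ = c x * (k₁ * (y * c u * v * u⁻¹)) * (k₂ * ((a v)⁻¹ * x⁻¹ * (a y)⁻¹)) := by group
    _ = c x * (y * c u * v * u⁻¹ * k₁) * ((a v)⁻¹ * x⁻¹ * (a y)⁻¹ * k₂) := by rw [h₁, h₂]
    _ = c x * y * (c u * v * u⁻¹) * (k₁ * ((a v)⁻¹ * x⁻¹ * (a y)⁻¹)) * k₂ := by group
    _ = c x * y * (c u * v * u⁻¹) * ((a v)⁻¹ * x⁻¹ * (a y)⁻¹ * k₁) * k₂ := by rw [h₁]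
    _ = c x * y * ((c u * v * u⁻¹ * (a v)⁻¹) * (x⁻¹ * (a y)⁻¹)) * k₁ * k₂ := by group
    _ = c x * y * (x⁻¹ * (a y)⁻¹ * (c u * v * u⁻¹ * (a v)⁻¹)) * k₁ * k₂ := by rw [h₃]
    _ = _ := by group

/-- The numerators occurring in the density of twisted commuting pairs. -/
def phaseNumerators (κ : ℕ) : Set ℝ :=
  (fun z : ℂ => (z / κ).re) '' insert 0 (rootAverages κ ((4 * κ) ^ κ ^ 3))

theorem finite_phaseNumerators {κ : ℕ} (hκ : 0 < κ) : (phaseNumerators κ).Finite :=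
  ((finite_rootAverages hκ _).insert 0).image _

theorem zero_mem_phaseNumerators (κ : ℕ) : (0 : ℝ) ∈ phaseNumerators κ :=
  ⟨0, Set.mem_insert _ _, by simp⟩

/-- Solutions are the points of `twistedKer a c` with trivial twisted commutator. Averaging over the
characters of the commutator subgroup detects them, and each character contributes the mean of a
quadratic phase. -/
theorem card_twisted_commuting_mem [Finite H] (hH : commutator H ≤ Subgroup.center H)
    (a c : H →* H) :
    (Nat.card {p : H × H // c p.1 * p.2 = a p.2 * p.1} : ℝ) / (Nat.card H : ℝ) ^ 2 ∈
      fractionSums (phaseNumerators (Nat.card (commutator H))) (Nat.card (commutator H)) := by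
  classical
  let := commGroupOfLeCenter hH
  set κ := Nat.card (commutator H) with hκ
  set L := twistedKer a c with hL
  have hκpos : 0 < κ := Nat.card_pos
  have : NeZero κ := ⟨hκpos.ne'⟩
  have := Fintype.ofFinite L
  have := Fintype.ofFinite (commutator H →* ℂˣ)
  let F : L → commutator H := fun p => ⟨twistedCommutator a c p, mem_twistedKer.1 p.2⟩
  let β : (commutator H →* ℂˣ) → L →* L →* ℂˣ := fun χ => MonoidHom.mk' (fun p =>
      (χ.comp (commutatorPairing hH (p : H × H).2)⁻¹).comp
        (c.comp ((MonoidHom.fst H H).comp L.subtype))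
      * (χ.comp (commutatorPairing hH (p : H × H).1)).comp
        (a.comp ((MonoidHom.snd H H).comp L.subtype)))
    fun p q => by
      ext r
      simp
      ring
  have hmul : ∀ χ : commutator H →* ℂˣ, ∀ p q : L, χ (F (p * q)) = χ (F p) * χ (F q) * β χ p q := by
    intro χ p q
    have : F (p * q) = F p * F q * ((commutatorPairing hH (p : H × H).2)⁻¹ (c (q : H × H).1) *
        commutatorPairing hH (p : H × H).1 (a (q : H × H).2)) := by
      exact Subtype.ext (twistedCommutator_mul hH a c q.2)
    rw [this, map_mul, map_mul]
    simp [β]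
  have hpow : ∀ χ : commutator H →* ℂˣ, ∀ p : L, χ (F p) ^ κ = 1 := fun χ p => by
    rw [← map_pow, hκ, pow_card_eq_one', map_one]
  choose num hnum den hden hsum using fun χ =>
    exists_sum_phase_eq_of_group (f := fun p => χ (F p)) (hmul χ) (hpow χ)
  have hcount : Nat.card {p : H × H // c p.1 * p.2 = a p.2 * p.1} =
      (Finset.univ.filter fun p : L => F p = 1).card := by
    rw [← Fintype.card_subtype, ← Nat.card_eq_fintype_card]
    have key : ∀ p : H × H, c p.1 * p.2 = a p.2 * p.1 ↔ twistedCommutator a c p = 1 := fun p => by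
      rw [twistedCommutator, mul_inv_eq_one, mul_inv_eq_iff_eq_mul]
    refine Nat.card_congr
      { toFun := fun p => ⟨⟨p, mem_twistedKer.2 (by rw [(key p).1 p.2]; exact one_mem _)⟩,
          Subtype.ext ((key p).1 p.2)⟩
        invFun := fun p => ⟨p.1, (key _).2 (congrArg Subtype.val p.2)⟩
        left_inv := fun _ => rfl
        right_inv := fun _ => rfl }
  have hcount' : (Nat.card {p : H × H // c p.1 * p.2 = a p.2 * p.1} : ℂ) * κ =
      ∑ χ : commutator H →* ℂˣ, ∑ p : L, (χ (F p) : ℂ) := by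
    rw [Finset.sum_comm, hcount]
    simp_rw [sum_monoidHom_units_eq]
    rw [← Finset.sum_filter, Finset.sum_const, nsmul_eq_mul]
  have hH0 : (Nat.card H : ℂ) ≠ 0 := Nat.cast_ne_zero.2 Nat.card_pos.ne'
  have hL0 : (Nat.card L : ℂ) ≠ 0 := Nat.cast_ne_zero.2 Nat.card_pos.ne'
  have hi0 : (L.index : ℂ) ≠ 0 := Nat.cast_ne_zero.2 L.index_ne_zero_of_finite
  have hκ0 : (κ : ℂ) ≠ 0 := Nat.cast_ne_zero.2 hκpos.ne'
  have hindex : (Nat.card L : ℂ) * L.index = (Nat.card H : ℂ) ^ 2 := by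
    have := L.card_mul_index
    rw [Nat.card_prod] at this
    exact_mod_cast this.trans (sq _).symm
  have hfinal : (Nat.card {p : H × H // c p.1 * p.2 = a p.2 * p.1} : ℂ) / (Nat.card H : ℂ) ^ 2 =
      ∑ χ : commutator H →* ℂˣ, num χ / κ / ((den χ * L.index : ℕ) : ℂ) := by
    have h1 : ∀ χ, num χ / κ / ((den χ * L.index : ℕ) : ℂ) =
        (∑ p : L, (χ (F p) : ℂ)) / (κ * (Nat.card H : ℂ) ^ 2) := fun χ => by
      have hd0 : (den χ : ℂ) ≠ 0 := Nat.cast_ne_zero.2 (hden χ).ne'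
      have := hsum χ
      rw [← hindex]
      field_simp at this ⊢
      push_cast
      linear_combination (L.index : ℂ) * this.symm
    rw [Finset.sum_congr rfl fun χ _ => h1 χ, ← Finset.sum_div, ← hcount']
    field_simp
  -- The density is real, so the complex numerators may be replaced by their real parts.
  have hre : (Nat.card {p : H × H // c p.1 * p.2 = a p.2 * p.1} : ℝ) / (Nat.card H : ℝ) ^ 2 =
      ∑ χ : commutator H →* ℂˣ, (num χ / κ).re / ((den χ * L.index : ℕ) : ℝ) := by
    have := congrArg Complex.re hfinal
    rw [Complex.re_sum] at this
    simp_rw [Complex.div_natCast_re] at this ⊢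
    rw [← this, ← Complex.ofReal_re ((Nat.card _ : ℝ) / (Nat.card H : ℝ) ^ 2)]
    push_cast
    rfl
  rw [hre]
  have hcard : (Finset.univ : Finset (commutator H →* ℂˣ)).card = κ := by
    rw [Finset.card_univ, ← Nat.card_eq_fintype_card,
      CommGroup.card_monoidHom_of_hasEnoughRootsOfUnity]
  have := sum_mem_fractionSums (C := phaseNumerators κ) (M := 1) Finset.univ
    (f := fun χ : commutator H →* ℂˣ => (num χ / κ).re / ((den χ * L.index : ℕ) : ℝ))
    (fun χ _ => by
      rw [← fractions_subset_fractionSums_one]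
      exact ⟨_, ⟨num χ, hnum χ, rfl⟩, _,
        Nat.mul_pos (hden χ) (Nat.pos_of_ne_zero L.index_ne_zero_of_finite), rfl⟩)
  rwa [hcard, mul_one] at this

end ClassTwo

/-! ### Commuting probability by cosets of a normal subgroup -/

section Cosets

theorem div_mem_fractionSums {C : Set ℝ} {M : ℕ} {x : ℝ} (hx : x ∈ fractionSums C M) (r : ℝ) :
    x / r ∈ fractionSums ((· / r) '' C) M := by
  induction M generalizing x with
  | zero =>
    rw [fractionSums, Set.mem_singleton_iff] at hx ⊢
    rw [hx, zero_div]
  | succ M ih =>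
    obtain ⟨y, hy, z, ⟨c, hc, m, hm, rfl⟩, rfl⟩ := hx
    change (y + c / m) / r ∈ _
    rw [add_div]
    exact Set.add_mem_add (ih hy) ⟨c / r, ⟨c, hc, rfl⟩, m, hm, by rw [div_right_comm]⟩

variable {G : Type*} [Group G] (H : Subgroup G)

/-- The commuting pairs lying in given cosets of `H`. -/
def cosetCommuting (s t : G ⧸ H) : Set (G × G) :=
  {p | Commute p.1 p.2 ∧ (p.1 : G ⧸ H) = s ∧ (p.2 : G ⧸ H) = t}

theorem commProb_eq_sum_cosetCommuting [Finite G] [Fintype (G ⧸ H)] :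
    (commProb G : ℝ) = ∑ q : (G ⧸ H) × (G ⧸ H),
      (Nat.card (cosetCommuting H q.1 q.2) : ℝ) / (Nat.card H : ℝ) ^ 2 / (H.index : ℝ) ^ 2 := by
  have h : Nat.card {p : G × G // Commute p.1 p.2} =
      ∑ q : (G ⧸ H) × (G ⧸ H), Nat.card (cosetCommuting H q.1 q.2) := by
    rw [← Nat.card_sigma]
    exact Nat.card_congr
      { toFun := fun p => ⟨(p.1.1, p.1.2), p.1, p.2, rfl, rfl⟩
        invFun := fun p => ⟨p.2.1, p.2.2.1⟩
        left_inv := fun _ => rfl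
        right_inv := by
          rintro ⟨⟨s, t⟩, p, hp, hs, ht⟩
          dsimp only at hs ht
          subst hs ht
          rfl }
  rw [commProb_def, h, ← H.card_mul_index]
  push_cast
  rw [Finset.sum_div]
  exact Finset.sum_congr rfl fun q _ => by rw [mul_pow, div_div]

variable [H.Normal]

/-- Once a commuting pair (g, g') in the two cosets is fixed, cancelling g g' = g' g turns
commutation of g h and g' h' into an equation in `H` twisted by two conjugations. -/
theorem card_cosetCommuting (s t : G ⧸ H) :
    Nat.card (cosetCommuting H s t) = 0 ∨ ∃ a c : H →* H,
      Nat.card (cosetCommuting H s t) = Nat.card {p : H × H // c p.1 * p.2 = a p.2 * p.1} := by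
  obtain he | ⟨⟨g, g'⟩, hgg' : g * g' = g' * g, hs, ht⟩ :=
    (cosetCommuting H s t).eq_empty_or_nonempty
  · exact Or.inl (by rw [he]; simp)
  refine Or.inr ⟨(MulAut.conjNormal (H := H) g⁻¹).toMonoidHom,
    (MulAut.conjNormal (H := H) g'⁻¹).toMonoidHom, Nat.card_congr ?_⟩
  have key : ∀ h h' : H, Commute (g * h) (g' * h') ↔
      MulAut.conjNormal g'⁻¹ h * h' = MulAut.conjNormal g⁻¹ h' * h := by
    intro h h'
    rw [Subtype.ext_iff, Subgroup.coe_mul, Subgroup.coe_mul, MulAut.conjNormal_apply,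
      MulAut.conjNormal_apply, inv_inv, inv_inv]
    have e₁ : g * h * (g' * h') = g * g' * (g'⁻¹ * h * g' * h') := by group
    have e₂ : g' * h' * (g * h) = g * g' * (g⁻¹ * h' * g * h) := by rw [hgg']; group
    rw [Commute, SemiconjBy, e₁, e₂, mul_left_cancel_iff]
  exact
    { toFun := fun p => ⟨(⟨g⁻¹ * p.1.1, QuotientGroup.eq.1 (hs.trans p.2.2.1.symm)⟩,
          ⟨g'⁻¹ * p.1.2, QuotientGroup.eq.1 (ht.trans p.2.2.2.symm)⟩), (key _ _).1 (by
            simpa using p.2.1)⟩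
      invFun := fun p => ⟨(g * p.1.1, g' * p.1.2), (key _ _).2 p.2, by
        simpa using hs, by simpa using ht⟩
      left_inv := fun p => by simp
      right_inv := fun p => Subtype.ext (by simp) }

theorem commProb_mem_fractionSums [Finite G]
    (hH : commutator H ≤ Subgroup.center H) :
    (commProb G : ℝ) ∈ fractionSums
      ((· / (H.index : ℝ) ^ 2) '' phaseNumerators (Nat.card (commutator H)))
      (H.index ^ 2 * Nat.card (commutator H)) := by
  have := Fintype.ofFinite (G ⧸ H)
  rw [commProb_eq_sum_cosetCommuting H]
  have hcard : (Finset.univ : Finset ((G ⧸ H) × (G ⧸ H))).card = H.index ^ 2 := by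
    rw [Finset.card_univ, Fintype.card_prod, ← Nat.card_eq_fintype_card, sq]
    rfl
  rw [← hcard]
  refine sum_mem_fractionSums _ fun q _ => div_mem_fractionSums ?_ _
  obtain h | ⟨a, c, h⟩ := card_cosetCommuting H q.1 q.2
  · rw [h, Nat.cast_zero, zero_div]
    exact fractionSums_le (zero_mem_phaseNumerators _) (Nat.zero_le _) rfl
  · rw [h]
    exact card_twisted_commuting_mem hH a c

/-- For abelian `H` the twisted equation defines a subgroup of H × H, whose density is the
reciprocal of its index. The numerators are therefore nonnegative, as well-foundedness requires. -/
theorem commProb_mem_fractionSums_of_comm [Finite G] (hH : commutator H = ⊥) :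
    (commProb G : ℝ) ∈ fractionSums {0, 1 / (H.index : ℝ) ^ 2} (H.index ^ 2) := by
  have := Fintype.ofFinite (G ⧸ H)
  rw [commProb_eq_sum_cosetCommuting H]
  have hcard : (Finset.univ : Finset ((G ⧸ H) × (G ⧸ H))).card = H.index ^ 2 := by
    rw [Finset.card_univ, Fintype.card_prod, ← Nat.card_eq_fintype_card, sq]
    rfl
  rw [← hcard, ← mul_one (Finset.card _)]
  have hC : ({0, 1 / (H.index : ℝ) ^ 2} : Set ℝ) = (· / (H.index : ℝ) ^ 2) '' {0, 1} := by
    rw [Set.image_pair, zero_div]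
  rw [hC]
  refine sum_mem_fractionSums _ fun q _ => div_mem_fractionSums ?_ _
  rw [← fractions_subset_fractionSums_one]
  obtain h | ⟨a, c, h⟩ := card_cosetCommuting H q.1 q.2
  · rw [h, Nat.cast_zero, zero_div]
    exact zero_mem_fractions (by simp)
  · have e : Nat.card {p : H × H // c p.1 * p.2 = a p.2 * p.1} = Nat.card (twistedKer a c) :=
      Nat.card_congr (Equiv.subtypeEquivRight fun p => by
        rw [mem_twistedKer, hH, Subgroup.mem_bot, twistedCommutator, mul_inv_eq_one,
          mul_inv_eq_iff_eq_mul])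
    refine ⟨1, by simp, (twistedKer a c).index,
      Nat.pos_of_ne_zero (twistedKer a c).index_ne_zero_of_finite, ?_⟩
    have hi := (twistedKer a c).card_mul_index
    rw [Nat.card_prod] at hi
    have hi' : (Nat.card (twistedKer a c) : ℝ) * (twistedKer a c).index = (Nat.card H : ℝ) ^ 2 := by
      rw [sq]
      exact_mod_cast hi
    have h1 : (Nat.card (twistedKer a c) : ℝ) ≠ 0 := Nat.cast_ne_zero.2 Nat.card_pos.ne'
    rw [h, e, ← hi', div_mul_cancel_left₀ h1, one_div]

/-- `G` has a normal subgroup of class at most two, of index at most `d`, whose commutator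
subgroup has order at most `κ`. -/
def IsBoundedlyAbelian (d κ : ℕ) (G : Type*) [Group G] : Prop :=
  ∃ H : Subgroup G, H.Normal ∧ H.index ≤ d ∧ commutator H ≤ Subgroup.center H ∧
    Nat.card (commutator H) ≤ κ

theorem exists_fractionSums_of_isBoundedlyAbelian (d κ : ℕ) :
    ∃ (C : Set ℝ) (M : ℕ), C.Finite ∧ (0 : ℝ) ∈ C ∧ ∀ (G : Type) [Group G] [Finite G],
      IsBoundedlyAbelian d κ G → (commProb G : ℝ) ∈ fractionSums C M := by
  refine ⟨insert 0 (⋃ i ∈ Finset.Icc 1 d, ⋃ j ∈ Finset.Icc 1 κ,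
    (· / (i : ℝ) ^ 2) '' phaseNumerators j), d ^ 2 * κ, ?_, Set.mem_insert _ _, ?_⟩
  · refine Set.Finite.insert _ (Set.Finite.biUnion (Finset.finite_toSet _) fun i _ =>
      Set.Finite.biUnion (Finset.finite_toSet _) fun j hj => ?_)
    exact (finite_phaseNumerators (Finset.mem_Icc.1 hj).1).image _
  · rintro G _ _ ⟨H, _, hd, hH, hκ⟩
    have hd0 : 1 ≤ H.index := Nat.pos_of_ne_zero H.index_ne_zero_of_finite
    have hκ0 : 1 ≤ Nat.card (commutator H) := Nat.card_pos
    refine fractionSums_le (Set.mem_insert _ _)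
      (Nat.mul_le_mul (Nat.pow_le_pow_left hd 2) hκ)
      (fractionSums_mono ?_ _ (commProb_mem_fractionSums H hH))
    refine Set.Subset.trans ?_ (Set.subset_insert _ _)
    intro x hx
    exact Set.mem_biUnion (Finset.mem_coe.2 (Finset.mem_Icc.2 ⟨hd0, hd⟩))
      (Set.mem_biUnion (Finset.mem_coe.2 (Finset.mem_Icc.2 ⟨hκ0, hκ⟩)) hx)

end Cosets

/-! ### Neumann's theorem on groups with many commuting pairs -/

section Neumann

open scoped commutatorElement Pointwise

variable {G : Type*} [Group G]

/-- The index of the centralizer of `x`, that is, the size of its conjugacy class. -/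
noncomputable def classSize (x : G) : ℕ := (Subgroup.centralizer {x}).index

theorem ncard_conjugatesOf (x : G) : (conjugatesOf x).ncard = classSize x := by
  have h := Subgroup.index_comap_of_surjective (MulAction.stabilizer (ConjAct G) x)
    (f := (ConjAct.toConjAct : G ≃* ConjAct G).toMonoidHom) ConjAct.toConjAct.surjective
  rw [MulAction.index_stabilizer] at h
  rw [classSize, Subgroup.centralizer_eq_comap_stabilizer]
  refine Eq.trans (congrArg Set.ncard ?_) h.symm
  ext y
  rw [ConjAct.mem_orbit_conjAct, isConj_comm]
  rfl

theorem card_centralizer_mul_classSize (x : G) :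
    Nat.card (Subgroup.centralizer {x}) * classSize x = Nat.card G :=
  Subgroup.card_mul_index _

theorem classSize_inv (x : G) : classSize x⁻¹ = classSize x := by
  rw [classSize, classSize]
  congr 1
  ext y
  rw [Subgroup.mem_centralizer_singleton_iff, Subgroup.mem_centralizer_singleton_iff]
  exact ⟨fun h => by simpa using (Commute.inv_right h : Commute y x⁻¹⁻¹).eq,
    fun h => (Commute.inv_right h : Commute y x⁻¹).eq⟩

/-- The elements with conjugacy class of size at most `b`. -/
def smallClasses (G : Type*) [Group G] (b : ℕ) : Set G := {x | classSize x ≤ b}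

theorem smallClasses_mono {b b' : ℕ} (h : b ≤ b') : smallClasses G b ⊆ smallClasses G b' :=
  fun _ hx => le_trans hx h

theorem card_commutator_eq (H : Subgroup G) :
    Nat.card (commutator H) = Nat.card (⁅H, H⁆ : Subgroup G) := by
  rw [← H.map_subtype_commutator]
  exact (Nat.card_congr (Subgroup.equivMapOfInjective _ _ H.subtype_injective).toEquiv)

theorem commutator_le_center_of_le_centralizer {H : Subgroup G}
    (h : H ≤ Subgroup.centralizer (⁅H, H⁆ : Subgroup G)) : commutator H ≤ Subgroup.center H := by
  intro z hz
  refine Subgroup.mem_center_iff.2 fun x => Subtype.ext ?_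
  have hz' : (z : G) ∈ ⁅H, H⁆ := by
    rw [← H.map_subtype_commutator]
    exact ⟨z, hz, rfl⟩
  exact (Subgroup.mem_centralizer_iff.1 (h x.2) z hz').symm

variable [Finite G]

theorem classSize_pos (x : G) : 0 < classSize x :=
  Nat.pos_of_ne_zero (Subgroup.index_ne_zero_of_finite)

theorem classSize_mul_le (x y : G) : classSize (x * y) ≤ classSize x * classSize y := by
  refine (Subgroup.index_antitone ?_).trans Subgroup.index_inf_le
  rintro z ⟨hx, hy⟩
  replace hx := Subgroup.mem_centralizer_singleton_iff.1 hx
  replace hy := Subgroup.mem_centralizer_singleton_iff.1 hy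
  rw [Subgroup.mem_centralizer_singleton_iff]
  exact (Commute.mul_right hx hy).eq

theorem card_commuting_eq_sum [Fintype G] :
    Nat.card {p : G × G // Commute p.1 p.2} = ∑ x : G, Nat.card (Subgroup.centralizer {x}) := by
  rw [← Nat.card_sigma]
  exact Nat.card_congr
    { toFun := fun p => ⟨p.1.1, p.1.2, Subgroup.mem_centralizer_singleton_iff.2 p.2.eq.symm⟩
      invFun := fun p => ⟨(p.1, p.2), (Subgroup.mem_centralizer_singleton_iff.1 p.2.2).symm⟩
      left_inv := fun _ => rfl
      right_inv := fun _ => rfl }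

/-- An element with class larger than b has centralizer of order at most |G| / b, so the small
classes fill a proportion at least ε - 1/b ≥ 1/b. -/
theorem card_le_mul_ncard_smallClasses {ε : ℝ} (hG : ε ≤ commProb G) {b : ℕ}
    (hb : 2 / ε ≤ b) (hε : 0 < ε) : Nat.card G ≤ b * (smallClasses G b).ncard := by
  classical
  have := Fintype.ofFinite G
  have hbpos : (0 : ℝ) < b := lt_of_lt_of_le (by positivity) hb
  have hG0 : (0 : ℝ) < Nat.card G := Nat.cast_pos.2 Nat.card_pos
  have hle : ∀ x : G, (Nat.card (Subgroup.centralizer {x}) : ℝ) ≤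
      (if x ∈ smallClasses G b then (Nat.card G : ℝ) else 0) + Nat.card G / b := by
    intro x
    have h := card_centralizer_mul_classSize x
    split_ifs with hx
    · have h1 : Nat.card (Subgroup.centralizer {x}) ≤ Nat.card G := Subgroup.card_le_card_group _
      have h2 : (0 : ℝ) ≤ Nat.card G / b := by positivity
      have : (Nat.card (Subgroup.centralizer {x}) : ℝ) ≤ Nat.card G := by exact_mod_cast h1
      linarith
    · rw [zero_add, le_div_iff₀ hbpos, ← h]
      push_cast
      gcongr
      exact (not_le.1 hx).le
  have hsum : (Nat.card {p : G × G // Commute p.1 p.2} : ℝ) ≤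
      (smallClasses G b).ncard * Nat.card G + Nat.card G * (Nat.card G / b) := by
    rw [card_commuting_eq_sum]
    push_cast
    refine (Finset.sum_le_sum fun x _ => hle x).trans_eq ?_
    rw [Finset.sum_add_distrib, ← Finset.sum_filter, Finset.sum_const, Finset.sum_const,
      nsmul_eq_mul, nsmul_eq_mul, Finset.card_univ, ← Nat.card_eq_fintype_card,
      Set.ncard_eq_toFinset_card']
    congr 4
    ext
    simp
  rw [commProb_def] at hG
  push_cast at hG
  rw [le_div_iff₀ (by positivity)] at hG
  have h1 : ε * Nat.card G ≤ (smallClasses G b).ncard + Nat.card G / b := by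
    refine le_of_mul_le_mul_right ?_ hG0
    calc ε * Nat.card G * Nat.card G = ε * (Nat.card G : ℝ) ^ 2 := by ring
      _ ≤ _ := hG.trans (hsum.trans_eq (by ring))
  have h2 : (2 : ℝ) ≤ ε * b := by
    rw [div_le_iff₀ hε] at hb
    linarith
  have h3 : ε * b * Nat.card G ≤ b * (smallClasses G b).ncard + Nat.card G := by
    have := mul_le_mul_of_nonneg_left h1 hbpos.le
    have h4 : (b : ℝ) * (Nat.card G / b) = Nat.card G := by field_simp
    nlinarith
  have h5 : (Nat.card G : ℝ) ≤ b * (smallClasses G b).ncard := by nlinarith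
  exact_mod_cast h5

/-- If no bound were stable, the set of small classes would double with every three squarings of the
bound; b doublings exceed |G|. -/
theorem exists_smallClasses_stable {b : ℕ}
    (hb : Nat.card G ≤ b * (smallClasses G b).ncard) :
    ∃ i ≤ 3 * b, smallClasses G ((b ^ 2 ^ i) ^ 2) ⊆ smallClasses G (b ^ 2 ^ i) := by
  by_contra! h
  have hsucc : ∀ i, b ^ 2 ^ (i + 1) = (b ^ 2 ^ i) ^ 2 := fun i => by rw [pow_succ 2 i, pow_mul]
  have hb1 : 1 ≤ b := by
    by_contra! h0
    have : 0 < Nat.card G := Nat.card_pos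
    rw [Nat.lt_one_iff.1 h0, zero_mul] at hb
    omega
  have hdouble : ∀ j ≤ b, 2 ^ j * (smallClasses G b).ncard ≤
      (smallClasses G (b ^ 2 ^ (3 * j))).ncard := by
    intro j
    induction j with
    | zero => simp
    | succ j ih =>
      intro hj
      -- Exclusion of y at stage 3j + 1 makes X and yX disjoint; its membership at stage 3j + 2
      -- keeps yX within stage 3j + 3.
      obtain ⟨y, hy, hy'⟩ := Set.not_subset.1 (h (3 * j + 1) (by omega))
      rw [← hsucc] at hy
      set X := smallClasses G (b ^ 2 ^ (3 * j)) with hX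
      have hsub : X ∪ (y * ·) '' X ⊆ smallClasses G (b ^ 2 ^ (3 * (j + 1))) := by
        refine Set.union_subset (smallClasses_mono ?_) ?_
        · exact Nat.pow_le_pow_right hb1 (Nat.pow_le_pow_right two_pos (by omega))
        · rintro _ ⟨x, hx, rfl⟩
          refine (classSize_mul_le y x).trans ?_
          change _ ≤ b ^ 2 ^ (3 * j + 2 + 1)
          rw [hsucc, sq]
          refine Nat.mul_le_mul hy (le_trans hx ?_)
          exact Nat.pow_le_pow_right hb1 (Nat.pow_le_pow_right two_pos (by omega))
      have hdisj : Disjoint X ((y * ·) '' X) := by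
        rw [Set.disjoint_left]
        rintro _ hx' ⟨x, hx, rfl⟩
        apply hy'
        change classSize y ≤ _
        rw [hsucc, sq, ← mul_inv_cancel_right y x]
        refine (classSize_mul_le _ _).trans (Nat.mul_le_mul hx' ?_)
        rw [classSize_inv]
        exact hx
      calc 2 ^ (j + 1) * (smallClasses G b).ncard
          = 2 * (2 ^ j * (smallClasses G b).ncard) := by ring
        _ ≤ 2 * X.ncard := Nat.mul_le_mul_left 2 (ih (by omega))
        _ = (X ∪ (y * ·) '' X).ncard := by
          rw [Set.ncard_union_eq hdisj, Set.ncard_image_of_injective _ (mul_right_injective y),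
            two_mul]
        _ ≤ _ := Set.ncard_le_ncard hsub
  have hlt : b < 2 ^ b := Nat.lt_two_pow_self
  have hpos : 0 < (smallClasses G b).ncard := by
    by_contra! h0
    have : 0 < Nat.card G := Nat.card_pos
    rw [Nat.le_zero.1 h0, mul_zero] at hb
    omega
  have h1 := hdouble b le_rfl
  have h2 : (smallClasses G (b ^ 2 ^ (3 * b))).ncard ≤ Nat.card G := by
    rw [← Set.ncard_univ]
    exact Set.ncard_le_ncard (Set.subset_univ _)
  nlinarith

/-- If squaring the bound does not add elements, the small classes form a subgroup. -/
def smallClassesSubgroup (b : ℕ) (hb : 0 < b)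
    (h : smallClasses G (b ^ 2) ⊆ smallClasses G b) : Subgroup G where
  carrier := smallClasses G b
  one_mem' := by
    have : classSize (1 : G) = 1 := by
      rw [classSize, Subgroup.index_eq_one, Subgroup.centralizer_eq_top_iff_subset]
      simp
    exact this.trans_le hb
  mul_mem' := fun {x y} hx hy => h ((classSize_mul_le x y).trans (by
    rw [sq]
    exact Nat.mul_le_mul hx hy))
  inv_mem' := fun {x} hx => (classSize_inv x).trans_le hx

/-- Take a with largest class and let C centralize one conjugator for each conjugate of a. For d in
C, the translate of the class of a by d lies in the class of d a, with equality by maximality.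
Taking d = c⁻¹ writes ⁅c, y⁆ as a quotient of two conjugates of a. -/
theorem exists_subgroup_few_commutators {b : ℕ} (hG : ∀ x : G, classSize x ≤ b) :
    ∃ C : Subgroup G, C.index ≤ b ^ b ∧ ∃ S : Set G, S.ncard ≤ b * b ∧
      ∀ c ∈ C, ∀ y, ⁅c, y⁆ ∈ S := by
  classical
  have hb : 0 < b := (classSize_pos 1).trans_le (hG 1)
  obtain ⟨a, ha⟩ := Finite.exists_max (classSize : G → ℕ)
  have hfin : ∀ x : G, (conjugatesOf x).Finite := fun x => Set.toFinite _
  have hconj : ∀ u : conjugatesOf a, ∃ r : G, r * a * r⁻¹ = u := fun u => isConj_iff.1 u.2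
  choose r hr using hconj
  have := Fintype.ofFinite (conjugatesOf a)
  refine ⟨⨅ u, Subgroup.centralizer {r u}, ?_, conjugatesOf a / conjugatesOf a, ?_, ?_⟩
  · refine (Subgroup.index_iInf_le _).trans ?_
    calc ∏ u, (Subgroup.centralizer {r u}).index ≤ ∏ _u : conjugatesOf a, b :=
          Finset.prod_le_prod' fun u _ => hG (r u)
      _ = b ^ classSize a := by
        rw [Finset.prod_const, Finset.card_univ, ← Nat.card_eq_fintype_card,
          Nat.card_coe_set_eq, ncard_conjugatesOf]
      _ ≤ b ^ b := Nat.pow_le_pow_right hb (hG a)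
  · rw [← Nat.card_coe_set_eq]
    refine Set.natCard_div_le.trans ?_
    rw [Nat.card_coe_set_eq, ncard_conjugatesOf]
    exact Nat.mul_le_mul (hG a) (hG a)
  · intro c hc y
    have hmul : ∀ d ∈ ⨅ u, Subgroup.centralizer {r u},
        (d * ·) '' conjugatesOf a = conjugatesOf (d * a) := by
      intro d hd
      refine Set.eq_of_subset_of_ncard_le ?_ ?_ (hfin _)
      · rintro _ ⟨u, hu, rfl⟩
        have hcomm := Subgroup.mem_centralizer_singleton_iff.1 (Subgroup.mem_iInf.1 hd ⟨u, hu⟩)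
        refine isConj_iff.2 ⟨r ⟨u, hu⟩, ?_⟩
        rw [← mul_assoc, ← hcomm, mul_assoc d, mul_assoc d, hr]
      · rw [Set.ncard_image_of_injective _ (mul_right_injective d), ncard_conjugatesOf,
          ncard_conjugatesOf]
        exact ha _
    have hmem : y * (c⁻¹ * a) * y⁻¹ ∈ (c⁻¹ * ·) '' conjugatesOf a := by
      rw [hmul _ (inv_mem hc)]
      exact isConj_iff.2 ⟨y, rfl⟩
    obtain ⟨u, hu, hu'⟩ := hmem
    refine ⟨u, hu, y * a * y⁻¹, isConj_iff.2 ⟨y, rfl⟩, ?_⟩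
    have hu'' : u = c * (y * (c⁻¹ * a) * y⁻¹) := by rw [← hu', mul_inv_cancel_left]
    change u / _ = _
    rw [hu'', commutatorElement_def, div_eq_mul_inv]
    group

theorem index_normalCore_le (H : Subgroup G) : H.normalCore.index ≤ H.index.factorial := by
  rw [Subgroup.normalCore_eq_ker, Subgroup.index_ker, Subgroup.index_eq_card, ← Nat.card_perm]
  exact Nat.card_le_card_of_injective _ Subtype.val_injective

/-- A bound for the size of the commutator subgroup in terms of the number of commutators,
monotone in the latter. -/
def commutatorBound (n : ℕ) : ℕ := ∑ i ∈ Finset.range (n + 1), Subgroup.cardCommutatorBound i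

theorem card_commutator_le_of_subset {H : Subgroup G} {S : Set G} {n : ℕ} (hn : S.ncard ≤ n)
    (hS : ∀ x ∈ H, ∀ y ∈ H, ⁅x, y⁆ ∈ S) : Nat.card (commutator H) ≤ commutatorBound n := by
  refine (Subgroup.card_commutator_le_of_finite_commutatorSet H).trans ?_
  refine Finset.single_le_sum (f := Subgroup.cardCommutatorBound) (fun _ _ => Nat.zero_le _) ?_
  rw [Finset.mem_range, Nat.lt_succ_iff]
  refine le_trans ?_ hn
  rw [← Nat.card_coe_set_eq]
  refine Nat.card_le_card_of_injective (fun z : commutatorSet H => (⟨(z : H), ?_⟩ : S)) ?_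
  · obtain ⟨_, x, y, rfl⟩ := z
    exact hS x x.2 y y.2
  · intro z w hzw
    exact Subtype.ext (Subtype.ext (Subtype.mk.inj hzw))

/-- A stable set of small classes is a subgroup of bounded index. It contains a subgroup of bounded
index with few commutators, and the normal core D of the latter has a bounded commutator subgroup.
-/
theorem exists_isBoundedlyAbelian {ε : ℝ} (hε : 0 < ε) :
    ∃ d κ : ℕ, ∀ (G : Type) [Group G] [Finite G], ε ≤ commProb G → IsBoundedlyAbelian d κ G := by
  obtain ⟨b₀, hb₀⟩ := exists_nat_ge (2 / ε)
  set B := b₀ ^ 2 ^ (3 * b₀) with hB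
  set d₁ := (B ^ B * b₀).factorial with hd₁
  set κ := commutatorBound (B * B) with hκ
  refine ⟨d₁ * B ^ κ, κ, fun G _ _ hG => ?_⟩
  have hb₀pos : 0 < b₀ := Nat.cast_pos.1 (lt_of_lt_of_le (by positivity : (0 : ℝ) < 2 / ε) hb₀)
  have hcard := card_le_mul_ncard_smallClasses hG hb₀ hε
  obtain ⟨i, hi, hstable⟩ := exists_smallClasses_stable hcard
  have hbi : b₀ ^ 2 ^ i ≤ B :=
    Nat.pow_le_pow_right hb₀pos (Nat.pow_le_pow_right two_pos hi)
  set H := smallClassesSubgroup (b₀ ^ 2 ^ i) (by positivity) hstable with hH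
  have hHB : ∀ x ∈ H, classSize x ≤ B := fun x hx => le_trans hx hbi
  have hHindex : H.index ≤ b₀ := by
    refine Nat.le_of_mul_le_mul_left ?_ (Nat.card_pos (α := H))
    rw [H.card_mul_index, mul_comm]
    refine hcard.trans (Nat.mul_le_mul_left _ ?_)
    rw [← SetLike.coe_sort_coe, Nat.card_coe_set_eq]
    exact Set.ncard_le_ncard (smallClasses_mono (Nat.le_self_pow (by positivity) _))
  have hHclass : ∀ x : H, classSize x ≤ B := by
    intro x
    refine le_trans ?_ (hHB x x.2)
    have hle : (Subgroup.centralizer {(x : G)}).subgroupOf H ≤ Subgroup.centralizer {x} := by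
      intro y hy
      rw [Subgroup.mem_subgroupOf, Subgroup.mem_centralizer_singleton_iff] at hy
      exact Subgroup.mem_centralizer_singleton_iff.2 (Subtype.ext hy)
    refine (Subgroup.index_antitone hle).trans ?_
    change (Subgroup.centralizer {(x : G)}).relIndex H ≤ _
    rw [classSize, ← Subgroup.relIndex_top_right]
    exact Subgroup.relIndex_le_of_le_right le_top
      (by rw [Subgroup.relIndex_top_right]; exact Subgroup.index_ne_zero_of_finite)
  obtain ⟨C, hC, S, hScard, hS⟩ := exists_subgroup_few_commutators hHclass
  set D := (C.map H.subtype).normalCore with hD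
  have hDindex : D.index ≤ d₁ := by
    refine (index_normalCore_le _).trans (Nat.factorial_le ?_)
    rw [Subgroup.index_map_subtype]
    exact Nat.mul_le_mul hC hHindex
  have hDC : ∀ x ∈ D, ∃ c ∈ C, (c : G) = x := fun x hx => Subgroup.normalCore_le _ hx
  have hDκ : Nat.card (commutator D) ≤ κ := by
    refine card_commutator_le_of_subset (S := H.subtype '' S) ?_ ?_
    · exact (Set.ncard_image_le (Set.toFinite _)).trans hScard
    · intro x hx y hy
      obtain ⟨c, hc, rfl⟩ := hDC x hx
      obtain ⟨c', hc', rfl⟩ := hDC y hy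
      exact ⟨_, hS c hc c', by simp⟩
  have hDH : D ≤ H := (Subgroup.normalCore_le _).trans (Subgroup.map_subtype_le _)
  set K := ⁅D, D⁆ with hK
  have hKH : K ≤ H := (Subgroup.commutator_le_self D).trans hDH
  have hKcard : Nat.card K ≤ κ := (card_commutator_eq D).symm.trans_le hDκ
  -- Centralizing K forces class two. The index stays bounded because K has at most κ elements, each
  -- with class of size at most B.
  set E := D ⊓ Subgroup.centralizer K with hE
  have hEK : ⁅E, E⁆ ≤ K := Subgroup.commutator_mono inf_le_left inf_le_left
  refine ⟨E, inferInstance, ?_, commutator_le_center_of_le_centralizer ?_, ?_⟩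
  · refine Subgroup.index_inf_le.trans (Nat.mul_le_mul hDindex ?_)
    have := Fintype.ofFinite K
    have hle : ⨅ k : K, Subgroup.centralizer {(k : G)} ≤ Subgroup.centralizer K := by
      intro x hx k hk
      exact (Subgroup.mem_centralizer_singleton_iff.1 (Subgroup.mem_iInf.1 hx ⟨k, hk⟩)).symm
    refine (Subgroup.index_antitone hle).trans ((Subgroup.index_iInf_le _).trans ?_)
    calc ∏ k : K, (Subgroup.centralizer {(k : G)}).index ≤ ∏ _k : K, B :=
          Finset.prod_le_prod' fun k _ => hHB k (hKH k.2)
      _ = B ^ Nat.card K := by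
        rw [Finset.prod_const, Finset.card_univ, Nat.card_eq_fintype_card]
      _ ≤ B ^ κ := Nat.pow_le_pow_right (by positivity) hKcard
  · exact inf_le_right.trans (Subgroup.centralizer_le hEK)
  · rw [card_commutator_eq]
    exact (Nat.card_le_card_of_injective _ (Subgroup.inclusion_injective hEK)).trans hKcard

end Neumann

/-! ### The commuting probability modulo a small commutator subgroup -/

section Perp

open scoped commutatorElement

variable {H : Type*} [Group H]

/-- The elements whose commutators with `A` lie in `M`, in a group of class two. -/
def perp (hH : commutator H ≤ Subgroup.center H) (A M : Subgroup H) : Subgroup H where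
  carrier := {x | ∀ y ∈ A, ⁅x, y⁆ ∈ M}
  one_mem' := fun y _ => by rw [commutatorElement_one_left]; exact one_mem _
  mul_mem' := fun {x x'} hx hx' y hy => by
    rw [commutatorElement_mul_left hH]
    exact mul_mem (hx y hy) (hx' y hy)
  inv_mem' := fun {x} hx y hy => by
    have h := commutatorElement_mul_left hH x x⁻¹ y
    rw [mul_inv_cancel, commutatorElement_one_left] at h
    rw [eq_inv_of_mul_eq_one_right h.symm]
    exact inv_mem (hx y hy)

variable [Finite H] (hH : commutator H ≤ Subgroup.center H) (A M : Subgroup H)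

/-- Record the commutators of x with representatives of the cosets of `A`. If all are trivial, every
commutator of x lies in `M`. -/
theorem card_perp_le :
    Nat.card (perp hH A M) ≤
      Nat.card (commutator H) ^ A.index * Nat.card (perp hH ⊤ M) := by
  let := commGroupOfLeCenter hH
  let φ : perp hH A M →* (H ⧸ A → commutator H) := MonoidHom.mk'
    (fun x q => commutatorPairing hH x q.out) (fun x y => by ext q; simp)
  rw [← φ.ker.index_mul_card, Subgroup.index_ker]
  refine Nat.mul_le_mul ?_ ?_
  · refine (Nat.card_le_card_of_injective _ Subtype.val_injective).trans ?_
    rw [Nat.card_fun]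
    rfl
  · have hker : ∀ x : φ.ker, ((x : perp hH A M) : H) ∈ perp hH ⊤ M := by
      intro x y _
      have hx : ⁅((x : perp hH A M) : H), (y : H ⧸ A).out⁆ = 1 :=
        congrArg Subtype.val (congrFun (MonoidHom.mem_ker.1 x.2) (y : H ⧸ A))
      have hmem : (y : H ⧸ A).out⁻¹ * y ∈ A := QuotientGroup.eq.1 (QuotientGroup.out_eq' _)
      rw [← mul_inv_cancel_left (y : H ⧸ A).out y, commutatorElement_mul_right hH, hx, one_mul]
      exact (x : perp hH A M).2 _ hmem
    exact Nat.card_le_card_of_injective (fun x => (⟨_, hker x⟩ : perp hH ⊤ M))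
      fun x y hxy => Subtype.ext (Subtype.ext (Subtype.mk.inj hxy))

/-- Either `A` has index at least N, or its index is so small that `card_perp_le` makes `perp hH A
M` a small subgroup. -/
theorem mul_card_mul_card_perp_le {N : ℕ}
    (hN : N * Nat.card (commutator H) ^ N ≤ (perp hH ⊤ M).index) :
    N * (Nat.card A * Nat.card (perp hH A M)) ≤ Nat.card H ^ 2 := by
  obtain h | h := le_total N A.index
  · calc N * (Nat.card A * Nat.card (perp hH A M))
        = (Nat.card A * N) * Nat.card (perp hH A M) := by ring
      _ ≤ (Nat.card A * A.index) * Nat.card H :=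
        Nat.mul_le_mul (Nat.mul_le_mul_left _ h) (Subgroup.card_le_card_group _)
      _ = Nat.card H ^ 2 := by rw [A.card_mul_index, sq]
  · calc N * (Nat.card A * Nat.card (perp hH A M))
        ≤ N * (Nat.card H * (Nat.card (commutator H) ^ N * Nat.card (perp hH ⊤ M))) := by
          refine Nat.mul_le_mul_left _ (Nat.mul_le_mul (Subgroup.card_le_card_group _)
            ((card_perp_le hH A M).trans (Nat.mul_le_mul_right _ ?_)))
          exact Nat.pow_le_pow_right Nat.card_pos h
      _ = Nat.card H * (Nat.card (perp hH ⊤ M) * (N * Nat.card (commutator H) ^ N)) := by ring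
      _ ≤ Nat.card H * (Nat.card (perp hH ⊤ M) * (perp hH ⊤ M).index) := by gcongr
      _ = Nat.card H ^ 2 := by rw [Subgroup.card_mul_index, sq]

end Perp

/-! ### Conjugation by elements of `G` on a normal subgroup modulo its commutators -/

section Displacement

open scoped commutatorElement

variable {G : Type*} [Group G] (H : Subgroup G)

variable {H} in
theorem coe_mem_commutator_iff {h : H} : (h : G) ∈ (⁅H, H⁆ : Subgroup G) ↔ h ∈ commutator H := by
  rw [← H.map_subtype_commutator]
  exact Subgroup.mem_map_iff_mem H.subtype_injective

variable [H.Normal]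

/-- The elements of `H` that commute with `x` modulo the commutator subgroup of `H`. -/
def centralizingPart (x : G) : Subgroup H :=
  MonoidHom.ker ((Abelianization.of.comp (MulAut.conjNormal (H := H) x).toMonoidHom) *
    (Abelianization.of)⁻¹)

variable {H} in
theorem mem_centralizingPart {x : G} {h : H} :
    h ∈ centralizingPart H x ↔ MulAut.conjNormal x h * h⁻¹ ∈ commutator H := by
  rw [centralizingPart, MonoidHom.mem_ker, ← Abelianization.ker_of, MonoidHom.mem_ker]
  simp

/-- The commutator with `x`, as a homomorphism into the commutator subgroup of `H`. -/
def displacement (hH : commutator H ≤ Subgroup.center H) (x : G) :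
    centralizingPart H x →* commutator H :=
  MonoidHom.mk' (fun h => ⟨MulAut.conjNormal x (h : H) * (h : H)⁻¹, mem_centralizingPart.1 h.2⟩)
    fun h k => Subtype.ext (by
      have hk := mul_comm_of_mem_commutator hH (mem_centralizingPart.1 k.2) (h : H)⁻¹
      simp only [Subgroup.coe_mul, map_mul, mul_inv_rev]
      rw [mul_assoc (MulAut.conjNormal x (h : H)), ← mul_assoc _ (k : H)⁻¹, hk]
      group)

/-- Elements of one coset of `H` with displacements in `M` therefore differ by an element of `perp`.
-/
theorem conjNormal_mul_inv_mul (hH : commutator H ≤ Subgroup.center H) (x : G) (k h : H)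
    (hx : h ∈ centralizingPart H x) :
    MulAut.conjNormal (k * x) h * h⁻¹ = MulAut.conjNormal x h * h⁻¹ * ⁅k, h⁆ := by
  have hc := mul_comm_of_mem_commutator hH (mem_centralizingPart.1 hx) k
  have e : MulAut.conjNormal (k * x) h = k * MulAut.conjNormal x h * k⁻¹ :=
    Subtype.ext (by simp [mul_assoc])
  rw [e, commutatorElement_def]
  calc k * MulAut.conjNormal x h * k⁻¹ * h⁻¹
      = k * (MulAut.conjNormal x h * h⁻¹) * (h * k⁻¹ * h⁻¹) := by group
    _ = MulAut.conjNormal x h * h⁻¹ * k * (h * k⁻¹ * h⁻¹) := by rw [hc]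
    _ = _ := by group

theorem centralizingPart_mul (x : G) (k : H) :
    centralizingPart H (k * x) = centralizingPart H x := by
  ext h
  rw [centralizingPart, centralizingPart, MonoidHom.mem_ker, MonoidHom.mem_ker]
  have e : MulAut.conjNormal (k * x) h = k * MulAut.conjNormal x h * k⁻¹ :=
    Subtype.ext (by simp [mul_assoc])
  change Abelianization.of (MulAut.conjNormal (k * x) h) * (Abelianization.of h)⁻¹ = 1 ↔
    Abelianization.of (MulAut.conjNormal x h) * (Abelianization.of h)⁻¹ = 1
  rw [e, map_mul, map_mul, map_inv, mul_comm (Abelianization.of k), mul_inv_cancel_right]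

/-- The elements of `G` commuting with `x` modulo the commutator subgroup of `H`. -/
def centralizerMod (x : G) : Subgroup G :=
  (Subgroup.centralizer {(x : G ⧸ (⁅H, H⁆ : Subgroup G))}).comap (QuotientGroup.mk' ⁅H, H⁆)

variable {H} in
theorem mem_centralizerMod {x y : G} : y ∈ centralizerMod H x ↔ ⁅x, y⁆ ∈ (⁅H, H⁆ : Subgroup G) := by
  rw [centralizerMod, Subgroup.mem_comap, Subgroup.mem_centralizer_singleton_iff,
    ← QuotientGroup.eq_one_iff, commutatorElement_def]
  set K : Subgroup G := ⁅H, H⁆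
  change (y : G ⧸ K) * x = x * y ↔ (x : G ⧸ K) * y * (x : G ⧸ K)⁻¹ * (y : G ⧸ K)⁻¹ = 1
  rw [mul_inv_eq_one, mul_inv_eq_iff_eq_mul, eq_comm]

theorem subgroupOf_centralizerMod (x : G) :
    (centralizerMod H x).subgroupOf H = centralizingPart H x := by
  ext h
  rw [Subgroup.mem_subgroupOf, mem_centralizerMod, mem_centralizingPart, ← coe_mem_commutator_iff,
    commutatorElement_def, Subgroup.coe_mul, MulAut.conjNormal_apply, Subgroup.coe_inv]

variable [Finite G]

theorem card_centralizerMod_le (x : G) :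
    Nat.card (centralizerMod H x) ≤ H.index * Nat.card (centralizingPart H x) := by
  have h1 : Nat.card (centralizingPart H x) = Nat.card (H.subgroupOf (centralizerMod H x)) := by
    rw [← subgroupOf_centralizerMod]
    exact Nat.card_congr
      { toFun := fun y => ⟨⟨y.1, y.2⟩, y.1.2⟩
        invFun := fun y => ⟨⟨y.1, y.2⟩, y.1.2⟩
        left_inv := fun _ => rfl
        right_inv := fun _ => rfl }
  rw [h1, ← (H.subgroupOf (centralizerMod H x)).index_mul_card]
  refine Nat.mul_le_mul_right _ ?_
  change H.relIndex _ ≤ _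
  rw [← Subgroup.relIndex_top_right]
  exact Subgroup.relIndex_le_of_le_right le_top
    (by rw [Subgroup.relIndex_top_right]; exact Subgroup.index_ne_zero_of_finite)

theorem card_centralizer_le_centralizerMod (x : G) :
    Nat.card (Subgroup.centralizer {x}) ≤ Nat.card (centralizerMod H x) := by
  refine Subgroup.card_le_of_le fun y hy => mem_centralizerMod.2 ?_
  rw [Subgroup.mem_centralizer_singleton_iff] at hy
  rw [commutatorElement_def, ← hy, mul_inv_cancel_right, mul_inv_cancel]
  exact one_mem _

/-- Preimages of the commutators under the surjective displacement translate the centralizer of x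
into disjoint subsets of `centralizerMod H x`. -/
theorem card_commutator_mul_card_centralizer_le (hH : commutator H ≤ Subgroup.center H) {x : G}
    (hx : (displacement H hH x).range = ⊤) :
    Nat.card (commutator H) * Nat.card (Subgroup.centralizer {x}) ≤
      Nat.card (centralizerMod H x) := by
  choose r hr using MonoidHom.range_eq_top.1 hx
  have hr' : ∀ k, ⁅x, ((r k : H) : G)⁆ = ((k : H) : G) := fun k => by
    have := congrArg (fun z : commutator H => ((z : H) : G)) (hr k)
    simpa [displacement, commutatorElement_def] using this
  rw [← Nat.card_prod]
  have hcomm : ∀ (k : commutator H) (z : Subgroup.centralizer {x}),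
      ⁅x, ((r k : H) : G) * z⁆ = ((k : H) : G) := by
    intro k z
    have hz := Subgroup.mem_centralizer_singleton_iff.1 z.2
    rw [← hr' k, commutatorElement_def, commutatorElement_def, mul_inv_rev]
    have : x * ((r k : H) * z) * x⁻¹ * ((z : G)⁻¹ * ((r k : H) : G)⁻¹) =
      x * (r k : H) * ((z * x⁻¹) * (z : G)⁻¹) * ((r k : H) : G)⁻¹ := by group
    rw [this, (Commute.inv_right hz : Commute (z : G) x⁻¹).eq, mul_inv_cancel_right]
  refine Nat.card_le_card_of_injective
    (fun p : commutator H × Subgroup.centralizer {x} =>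
      (⟨(r p.1 : H) * p.2, ?_⟩ : centralizerMod H x)) ?_
  · rw [mem_centralizerMod, hcomm, coe_mem_commutator_iff]
    exact p.1.2
  · rintro ⟨k, z⟩ ⟨k', z'⟩ h
    have h' : ((r k : H) : G) * z = (r k' : H) * z' := Subtype.mk.inj h
    have hk : k = k' := by
      refine Subtype.ext (Subtype.ext ?_)
      rw [← hcomm k z, h', hcomm]
    subst hk
    simpa using h'

theorem sum_centralizerMod [Fintype G] :
    (∑ x : G, (Nat.card (centralizerMod H x) : ℝ)) =
      commProb (G ⧸ (⁅H, H⁆ : Subgroup G)) * (Nat.card G : ℝ) ^ 2 := by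
  classical
  set K : Subgroup G := ⁅H, H⁆ with hK
  have := Fintype.ofFinite (G ⧸ K)
  have hKpos : (0 : ℝ) < Nat.card K := Nat.cast_pos.2 Nat.card_pos
  have hQpos : (0 : ℝ) < Nat.card (G ⧸ K) := Nat.cast_pos.2 Nat.card_pos
  have hG : (Nat.card G : ℝ) = Nat.card (G ⧸ K) * Nat.card K := by
    exact_mod_cast K.card_eq_card_quotient_mul_card_subgroup
  have hcard : ∀ x : G, (Nat.card (centralizerMod H x) : ℝ) =
      Nat.card K * Nat.card (Subgroup.centralizer {(x : G ⧸ K)}) := by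
    intro x
    have h1 := (centralizerMod H x).card_mul_index
    have h2 := (Subgroup.centralizer {(x : G ⧸ K)}).card_mul_index
    have h3 : (centralizerMod H x).index = (Subgroup.centralizer {(x : G ⧸ K)}).index :=
      Subgroup.index_comap_of_surjective _ (QuotientGroup.mk'_surjective K)
    have h4 : (0 : ℕ) < (Subgroup.centralizer {(x : G ⧸ K)}).index :=
      Nat.pos_of_ne_zero Subgroup.index_ne_zero_of_finite
    rw [h3, K.card_eq_card_quotient_mul_card_subgroup, ← h2] at h1
    have h5 : Nat.card (centralizerMod H x) =
        Nat.card K * Nat.card (Subgroup.centralizer {(x : G ⧸ K)}) := by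
      refine Nat.eq_of_mul_eq_mul_right h4 (h1.trans (by ring))
    exact_mod_cast h5
  simp_rw [hcard]
  rw [← Finset.mul_sum, ← Finset.sum_fiberwise (s := Finset.univ) (g := fun x : G => (x : G ⧸ K))]
  have hfib : ∀ q : G ⧸ K, ∑ x ∈ Finset.univ.filter (fun x : G => (x : G ⧸ K) = q),
      (Nat.card (Subgroup.centralizer {(x : G ⧸ K)}) : ℝ) =
      Nat.card K * Nat.card (Subgroup.centralizer {q}) := by
    intro q
    rw [Finset.sum_congr rfl (g := fun _ => (Nat.card (Subgroup.centralizer {q}) : ℝ))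
      (fun x hx => by rw [(Finset.mem_filter.1 hx).2]), Finset.sum_const, nsmul_eq_mul,
      card_filter_mk_eq]
  rw [Finset.sum_congr rfl fun q _ => hfib q, ← Finset.mul_sum, commProb_def, card_commuting_eq_sum,
    hG]
  push_cast
  field_simp
  rfl

end Displacement

/-! ### Well-foundedness of the set of commuting probabilities -/

section WellFounded

open scoped commutatorElement

/-! ### Comparison of `G` with its quotient by `⁅H, H⁆` -/

section Estimate

/-- The normal core of `perp hH ⊤ M` has its commutators in `M`, which is central in `H` and
strictly smaller than the commutator subgroup. -/
theorem isBoundedlyAbelian_of_small_perp {G : Type*} [Group G] [Finite G] {H : Subgroup G}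
    (hH : commutator H ≤ Subgroup.center H)
    {M : Subgroup H}
    (hM : M < commutator H) {d Z κ : ℕ} (hd : H.index ≤ d) (hZ : (perp hH ⊤ M).index ≤ Z)
    (hκ : Nat.card (commutator H) ≤ κ + 1) :
    IsBoundedlyAbelian (Z * d).factorial κ G := by
  set D := ((perp hH ⊤ M).map H.subtype).normalCore with hD
  have hDM : (⁅D, D⁆ : Subgroup G) ≤ M.map H.subtype := by
    rw [Subgroup.commutator_le]
    intro x hx y hy
    obtain ⟨x', hx', rfl⟩ : ∃ x' ∈ perp hH ⊤ M, (x' : G) = x := Subgroup.normalCore_le _ hx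
    obtain ⟨y', -, rfl⟩ : ∃ y' ∈ perp hH ⊤ M, (y' : G) = y := Subgroup.normalCore_le _ hy
    exact ⟨⁅x', y'⁆, hx' y' (Subgroup.mem_top y'), by simp⟩
  have hDH : D ≤ H := (Subgroup.normalCore_le _).trans (Subgroup.map_subtype_le _)
  refine ⟨D, inferInstance, ?_, commutator_le_center_of_le_centralizer ?_, ?_⟩
  · refine (index_normalCore_le _).trans (Nat.factorial_le ?_)
    rw [Subgroup.index_map_subtype]
    exact Nat.mul_le_mul hZ hd
  · intro x hx z hz
    obtain ⟨z', hz', rfl⟩ : ∃ z' ∈ M, (z' : G) = z := hDM hz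
    exact congrArg Subtype.val (mul_comm_of_mem_commutator hH (hM.le hz') ⟨x, hDH hx⟩)
  · rw [card_commutator_eq]
    have h1 : Nat.card (⁅D, D⁆ : Subgroup G) ≤ Nat.card M := by
      rw [Nat.card_congr (Subgroup.equivMapOfInjective M _ H.subtype_injective).toEquiv]
      exact Subgroup.card_le_of_le hDM
    have h2 : Nat.card M < Nat.card (commutator H) := by
      refine lt_of_le_of_ne (Subgroup.card_le_of_le hM.le) fun heq => ?_
      exact hM.ne (Subgroup.eq_of_le_of_card_ge hM.le heq.ge)
    omega

variable {G : Type*} [Group G] [Finite G] (H : Subgroup G) [H.Normal]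

/-- The elements whose displacements of `H` stay in `M`. -/
def smallDisplacement (M : Subgroup H) : Set G :=
  {x | ∀ h ∈ centralizingPart H x, MulAut.conjNormal x h * h⁻¹ ∈ M}

/-- Relative to a base point x₀, the fiber embeds in `perp hH A M`, and each term is at most the
index of `H` times |A|, with A the common centralizing part. -/
theorem sum_fiber_smallDisplacement_le [Fintype G] (hH : commutator H ≤ Subgroup.center H)
    (M : Subgroup H) {N : ℕ} (hN : N * Nat.card (commutator H) ^ N ≤ (perp hH ⊤ M).index)
    (q : G ⧸ H) (s : Finset G) (hs : ∀ x ∈ s, x ∈ smallDisplacement H M ∧ (x : G ⧸ H) = q) :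
    N * ∑ x ∈ s, Nat.card (centralizerMod H x) ≤ H.index * Nat.card H ^ 2 := by
  obtain rfl | ⟨x₀, hx₀⟩ := s.eq_empty_or_nonempty
  · simp
  set A := centralizingPart H x₀ with hA
  have hquot : ∀ x ∈ s, x * x₀⁻¹ ∈ H := fun x hx =>
    (inferInstance : H.Normal).mem_comm
      (QuotientGroup.eq.1 ((hs x₀ hx₀).2.trans (hs x hx).2.symm))
  have hx : ∀ x (hx : x ∈ s), ((⟨x * x₀⁻¹, hquot x hx⟩ : H) : G) * x₀ = x := fun x _ => by simp
  have hperp : ∀ x (hx : x ∈ s), (⟨x * x₀⁻¹, hquot x hx⟩ : H) ∈ perp hH A M := by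
    intro x hxs h hh
    have h1 := conjNormal_mul_inv_mul H hH x₀ ⟨x * x₀⁻¹, hquot x hxs⟩ h hh
    have h2 := (hs x hxs).1 h (by
      rw [← hx x hxs, centralizingPart_mul]
      exact hh)
    rw [hx x hxs] at h1
    rw [h1] at h2
    exact (M.mul_mem_cancel_left ((hs x₀ hx₀).1 h hh)).1 h2
  have hterm : ∀ x ∈ s, Nat.card (centralizerMod H x) ≤ H.index * Nat.card A := by
    intro x hxs
    refine (card_centralizerMod_le H x).trans_eq ?_
    rw [← hx x hxs, centralizingPart_mul]
  have hcard : s.card ≤ Nat.card (perp hH A M) := by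
    rw [← Fintype.card_coe, ← Nat.card_eq_fintype_card]
    refine Nat.card_le_card_of_injective
      (fun x : s => (⟨⟨x * x₀⁻¹, hquot x x.2⟩, hperp x x.2⟩ : perp hH A M)) fun x y hxy => ?_
    have h1 := congrArg (fun z : perp hH A M => ((z : H) : G)) hxy
    exact Subtype.ext (mul_right_cancel (b := x₀⁻¹) h1)
  calc N * ∑ x ∈ s, Nat.card (centralizerMod H x)
      ≤ N * (s.card * (H.index * Nat.card A)) := by
        gcongr
        exact Finset.sum_le_card_nsmul _ _ _ hterm
    _ ≤ N * (Nat.card (perp hH A M) * (H.index * Nat.card A)) := by gcongr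
    _ = H.index * (N * (Nat.card A * Nat.card (perp hH A M))) := by ring
    _ ≤ H.index * Nat.card H ^ 2 := by
        gcongr
        exact mul_card_mul_card_perp_le hH A M hN

open Classical in
theorem sum_smallDisplacement_le [Fintype G] (hH : commutator H ≤ Subgroup.center H)
    (M : Subgroup H) {N : ℕ} (hN : N * Nat.card (commutator H) ^ N ≤ (perp hH ⊤ M).index) :
    N * ∑ x : G with x ∈ smallDisplacement H M, Nat.card (centralizerMod H x) ≤
      Nat.card G ^ 2 := by
  have := Fintype.ofFinite (G ⧸ H)
  rw [← Finset.sum_fiberwise (g := fun x : G => (x : G ⧸ H)), Finset.mul_sum]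
  calc _ ≤ ∑ _q : G ⧸ H, H.index * Nat.card H ^ 2 :=
        Finset.sum_le_sum fun q _ => sum_fiber_smallDisplacement_le H hH M hN q _ fun x hx => by
          simpa using hx
    _ = Nat.card G ^ 2 := by
        rw [Finset.sum_const, Finset.card_univ, ← Nat.card_eq_fintype_card, smul_eq_mul,
          ← H.card_mul_index]
        change H.index * _ = _
        ring

/-- When the displacement of x is onto, the centralizer of x is at most 1/κ of the centralizer
modulo `⁅H, H⁆`; summing gives the main term. Every other x has displacements in a proper subgroup
of the commutator subgroup. There are at most 2^κ of these, each contributing at most |G|^2 / N. -/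
theorem commProb_le_of_large_perp (hH : commutator H ≤ Subgroup.center H) {N : ℕ} (hN0 : 0 < N)
    (hN : ∀ M : Subgroup H, M < commutator H →
      N * Nat.card (commutator H) ^ N ≤ (perp hH ⊤ M).index) :
    (commProb G : ℝ) ≤ commProb (G ⧸ (⁅H, H⁆ : Subgroup G)) / Nat.card (commutator H) +
      2 ^ Nat.card (commutator H) / N := by
  classical
  have := Fintype.ofFinite G
  set κ := Nat.card (commutator H) with hκ
  have hκ0 : (0 : ℝ) < κ := Nat.cast_pos.2 Nat.card_pos
  have hN0' : (0 : ℝ) < N := Nat.cast_pos.2 hN0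
  have hG0 : (0 : ℝ) < Nat.card G := Nat.cast_pos.2 Nat.card_pos
  have := Fintype.ofFinite (Subgroup (commutator H))
  set F := (Finset.univ : Finset (Subgroup (commutator H))).filter (· ≠ ⊤) with hF
  have hFcard : (F.card : ℝ) ≤ 2 ^ κ := by
    have h1 : F.card ≤ 2 ^ κ := by
      refine (Finset.card_le_univ _).trans ?_
      rw [← Nat.card_eq_fintype_card]
      refine (Nat.card_le_card_of_injective
        (fun M : Subgroup (commutator H) => (M : Set (commutator H)))
        SetLike.coe_injective).trans_eq ?_
      have := Fintype.ofFinite (commutator H)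
      rw [Nat.card_eq_fintype_card, Fintype.card_set, ← Nat.card_eq_fintype_card]
    exact_mod_cast h1
  have hterm : ∀ x : G, (Nat.card (Subgroup.centralizer {x}) : ℝ) ≤
      Nat.card (centralizerMod H x) / κ +
        ∑ M ∈ F, if x ∈ smallDisplacement H (M.map (commutator H).subtype) then
          (Nat.card (centralizerMod H x) : ℝ) else 0 := by
    intro x
    have hnn : ∀ M ∈ F, 0 ≤ if x ∈ smallDisplacement H (M.map (commutator H).subtype) then
        (Nat.card (centralizerMod H x) : ℝ) else 0 := fun M _ => by split_ifs <;> positivity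
    by_cases hx : (displacement H hH x).range = ⊤
    · refine le_add_of_le_of_nonneg ?_ (Finset.sum_nonneg hnn)
      rw [le_div_iff₀ hκ0, mul_comm]
      exact_mod_cast card_commutator_mul_card_centralizer_le H hH hx
    · refine le_add_of_nonneg_of_le (by positivity) ?_
      have hmem : (displacement H hH x).range ∈ F := by simpa [hF] using hx
      refine le_trans ?_ (Finset.single_le_sum hnn hmem)
      rw [if_pos]
      · exact_mod_cast card_centralizer_le_centralizerMod H x
      · intro h hh
        exact ⟨displacement H hH x ⟨h, hh⟩, ⟨_, rfl⟩, rfl⟩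
  have hbad : ∀ M ∈ F, (∑ x : G, if x ∈ smallDisplacement H (M.map (commutator H).subtype) then
      (Nat.card (centralizerMod H x) : ℝ) else 0) ≤ (Nat.card G : ℝ) ^ 2 / N := by
    intro M hM
    have hlt : M.map (commutator H).subtype < commutator H := by
      refine lt_of_le_of_ne (Subgroup.map_subtype_le _) fun heq => ?_
      refine (Finset.mem_filter.1 hM).2 (Subgroup.map_injective (commutator H).subtype_injective ?_)
      rw [heq, ← MonoidHom.range_eq_map, Subgroup.range_subtype]
    have h1 := sum_smallDisplacement_le H hH _ (hN _ hlt)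
    rw [← Finset.sum_filter, le_div_iff₀ hN0', mul_comm]
    exact_mod_cast h1
  have hsum : (Nat.card {p : G × G // Commute p.1 p.2} : ℝ) ≤
      commProb (G ⧸ (⁅H, H⁆ : Subgroup G)) * (Nat.card G : ℝ) ^ 2 / κ +
        2 ^ κ * ((Nat.card G : ℝ) ^ 2 / N) := by
    rw [card_commuting_eq_sum]
    push_cast
    refine (Finset.sum_le_sum fun x _ => hterm x).trans ?_
    rw [Finset.sum_add_distrib, ← Finset.sum_div, sum_centralizerMod, Finset.sum_comm]
    gcongr
    refine (Finset.sum_le_sum hbad).trans ?_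
    rw [Finset.sum_const, nsmul_eq_mul]
    gcongr
  rw [commProb_def]
  push_cast
  rw [div_le_iff₀ (by positivity)]
  refine hsum.trans_eq ?_
  ring

theorem commProb_quotient_div_le :
    (commProb (G ⧸ (⁅H, H⁆ : Subgroup G)) : ℝ) / Nat.card (commutator H) ≤ commProb G := by
  rw [div_le_iff₀ (Nat.cast_pos.2 Nat.card_pos), card_commutator_eq]
  exact_mod_cast Subgroup.commProb_quotient_le (⁅H, H⁆ : Subgroup G)

theorem commProb_quotient_mem_fractionSums :
    (commProb (G ⧸ (⁅H, H⁆ : Subgroup G)) : ℝ) ∈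
      fractionSums {0, 1 / (H.index : ℝ) ^ 2} (H.index ^ 2) := by
  set K : Subgroup G := ⁅H, H⁆ with hK
  have hKH : K ≤ H := Subgroup.commutator_le_self H
  have hindex : (H.map (QuotientGroup.mk' K)).index = H.index :=
    Subgroup.index_map_eq _ (QuotientGroup.mk'_surjective K) (by simpa using hKH)
  have hnormal : (H.map (QuotientGroup.mk' K)).Normal :=
    Subgroup.Normal.map inferInstance _ (QuotientGroup.mk'_surjective K)
  rw [← hindex]
  refine commProb_mem_fractionSums_of_comm _ ?_
  have h1 :
      (⁅H.map (QuotientGroup.mk' K), H.map (QuotientGroup.mk' K)⁆ : Subgroup (G ⧸ K)) = ⊥ := by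
    rw [← Subgroup.map_commutator, Subgroup.map_eq_bot_iff, QuotientGroup.ker_mk']
  rw [← Subgroup.card_eq_one, card_commutator_eq, h1, Subgroup.card_bot]

end Estimate

/-- The commuting probabilities of the groups that are boundedly abelian. -/
def boundedCommProbSet (d κ : ℕ) : Set ℝ :=
  {x | ∃ (G : Type) (_ : Group G) (_ : Finite G), IsBoundedlyAbelian d κ G ∧ x = commProb G}

/-- Approximation by fraction sums with nonnegative numerators handles the groups in which all the
relevant `perp` indices are large; a bounded one lowers κ at the cost of a larger d, which is why d
is quantified inside the induction. -/
theorem wellFoundedOn_boundedCommProbSet (κ : ℕ) :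
    ∀ d, (boundedCommProbSet d κ).WellFoundedOn (· > ·) := by
  induction κ with
  | zero =>
    intro d
    convert Set.wellFoundedOn_empty (α := ℝ) (r := (· > ·))
    refine Set.eq_empty_of_forall_notMem ?_
    rintro x ⟨G, _, _, ⟨H, -, -, -, hH⟩, -⟩
    exact absurd hH (Nat.card_pos (α := commutator H)).not_ge
  | succ κ ih =>
    intro d
    set C : Set ℝ := insert 0 (⋃ i ∈ Finset.Icc 1 d, ⋃ j ∈ Finset.Icc 1 (κ + 1),
      (· / (j : ℝ)) '' {0, 1 / (i : ℝ) ^ 2}) with hC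
    have hCfin : C.Finite := Set.Finite.insert _ (Set.Finite.biUnion (Finset.finite_toSet _)
      fun i _ => Set.Finite.biUnion (Finset.finite_toSet _) fun j _ => (Set.toFinite _).image _)
    have hC0 : ∀ c ∈ C, 0 ≤ c := by
      rintro c (rfl | hc)
      · exact le_rfl
      · simp only [Set.mem_iUnion, Set.mem_image] at hc
        obtain ⟨i, -, j, -, y, rfl | rfl, rfl⟩ := hc <;> positivity
    refine wellFoundedOn_gt_of_approx (E := fractionSums C (d ^ 2)) ?_
      (wellFoundedOn_gt_fractionSums hCfin hC0 _) fun δ hδ => ?_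
    · refine ⟨1, ?_⟩
      rintro x ⟨G, _, _, -, rfl⟩
      exact_mod_cast commProb_le_one G
    obtain ⟨N, hN⟩ := exists_nat_gt (2 ^ (κ + 1) / δ)
    have hN0 : (0 : ℝ) < N := lt_trans (by positivity) hN
    set Z := N * (κ + 1) ^ N with hZ
    refine ⟨boundedCommProbSet (Z * d).factorial κ, ih _, ?_⟩
    rintro x ⟨G, _, _, ⟨H, hHn, hd, hH, hκ⟩, rfl⟩
    by_cases hM : ∀ M : Subgroup H, M < commutator H →
      N * Nat.card (commutator H) ^ N ≤ (perp hH ⊤ M).index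
    · refine Or.inr ⟨_, ?_, commProb_quotient_div_le H,
        (commProb_le_of_large_perp H hH (Nat.cast_pos.1 hN0) hM).trans ?_⟩
      · have hd0 : 1 ≤ H.index := Nat.pos_of_ne_zero H.index_ne_zero_of_finite
        have hκ0 : 1 ≤ Nat.card (commutator H) := Nat.card_pos
        refine fractionSums_le (Set.mem_insert _ _) (Nat.pow_le_pow_left hd 2)
          (fractionSums_mono ?_ _
            (div_mem_fractionSums (commProb_quotient_mem_fractionSums H) _))
        refine Set.Subset.trans ?_ (Set.subset_insert _ _)
        intro x hx
        exact Set.mem_biUnion (Finset.mem_coe.2 (Finset.mem_Icc.2 ⟨hd0, hd⟩))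
          (Set.mem_biUnion (Finset.mem_coe.2 (Finset.mem_Icc.2 ⟨hκ0, hκ⟩)) hx)
      · gcongr
        rw [div_lt_iff₀ hδ] at hN
        rw [div_le_iff₀ hN0]
        calc (2 : ℝ) ^ Nat.card (commutator H) ≤ 2 ^ (κ + 1) :=
              pow_le_pow_right₀ one_le_two hκ
          _ ≤ δ * N := by linarith
    · push Not at hM
      obtain ⟨M, hM, hlt⟩ := hM
      refine Or.inl ⟨G, inferInstance, ‹Finite G›,
        isBoundedlyAbelian_of_small_perp hH hM hd (hlt.le.trans ?_) hκ, rfl⟩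
      exact Nat.mul_le_mul_left _ (Nat.pow_le_pow_left hκ N)

theorem commProbSet_inter_Ici_subset {ε : ℝ} (hε : 0 < ε) :
    ∃ d κ : ℕ, commProbSet ∩ Set.Ici ε ⊆ boundedCommProbSet d κ := by
  obtain ⟨d, κ, h⟩ := exists_isBoundedlyAbelian hε
  refine ⟨d, κ, ?_⟩
  rintro x ⟨⟨G, _, _, rfl⟩, hx⟩
  exact ⟨G, inferInstance, ‹Finite G›, h G hx, rfl⟩

theorem commProbSet_pos {x : ℝ} (hx : x ∈ commProbSet) : 0 < x := by
  obtain ⟨G, _, _, rfl⟩ := hx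
  exact_mod_cast commProb_pos G

theorem wellFoundedOn_commProbSet : commProbSet.WellFoundedOn (· > ·) :=
  wellFoundedOn_gt_of_inter_Ici fun _ hx =>
    let ⟨d, κ, h⟩ := commProbSet_inter_Ici_subset (commProbSet_pos hx)
    (wellFoundedOn_boundedCommProbSet κ d).subset h

-- A larger type would give an element x with exactly `ω ^ ω` predecessors. All of them are at least
-- x > 0, hence lie in a single set of fraction sums, which has no room even for `ω ^ (M + 1)`.
open Ordinal in
theorem type_commProbSet_le [IsWellOrder commProbSet (fun x y => x > y)] :
    Ordinal.type (fun x y : commProbSet => x > y) ≤ ω ^ ω := by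
  by_contra! hlt
  obtain ⟨x, hx⟩ := typein_surj (fun x y : commProbSet => x > y) hlt
  obtain ⟨d, κ, h⟩ := commProbSet_inter_Ici_subset (commProbSet_pos x.2)
  obtain ⟨C, M, hC, hC0, hCM⟩ := exists_fractionSums_of_isBoundedlyAbelian d κ
  have hle : ω ^ ((M + 1 : ℕ) : Ordinal.{0}) ≤ typein (fun x y : commProbSet => x > y) x := by
    refine le_of_le_of_eq (opow_le_opow_right omega0_pos ?_) hx.symm
    exact (natCast_lt_omega0 _).le
  refine not_containsDecreasing_fractionSums hC hC0 M
    ((containsDecreasing_of_le_typein x hle).mono (h.trans ?_))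
  rintro _ ⟨G, _, _, hG, rfl⟩
  exact hCM G hG

end WellFounded

theorem mainTheorem3 :
    ∃ h : IsWellOrder commProbSet (fun x y => x > y),
      @Ordinal.type commProbSet (fun x y => x > y) h = ω ^ ω := by
  have h := isWellOrder_gt_of_wellFoundedOn wellFoundedOn_commProbSet
  exact ⟨h, le_antisymm type_commProbSet_le opow_omega0_le_type_commProbSet⟩
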